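/- \textbf{Conventions.} Let $M$ be a non-empty smooth manifold of dimension $4m$, $m\ge 1$. An HKT structure $(g,I,J,K)$ on an open set consists of integrable complex structures $I,J,K$ satisfying the quaternion identities $IJ=K=-JI$ and a pseudo-Riemannian metric $g$ (of any signature) that is Hermitian with respect to $I$, $J$ and $K$, such that there is a smooth connection $\nabla$ with $\nabla g=\nabla I=\nabla J=\nabla K=0$ whose torsion $T(Y,Z)=\nabla_YZ-\nabla_ZY-[Y,Z]$ makes $c(X,Y,Z)=g(X,T(Y,Z))$ totally skew. Put $F_I(Y,Z)=g(IY,Z)$, and for an $r$-form $\beta$ put $I\beta=\beta(-I\cdot,\dots,-I\cdot)$ and $d_I\beta=(-1)^rI\,d\,I\beta$ (similarly for $J,K$). A smooth function $\phi$ is a potential for $g$ if $F_I=\tfrac12(dd_I+d_Jd_K)\phi$, and likewise for the cyclic permutations of $(I,J,K)$. A smooth vector field $X$ is a special homothety of type $(a,b)\in\mathbb R^2$ if $L_Xg=a\,g$ and, together with all cyclic permutations of $(I,J,K)$, $L_{IX}g=0$, $L_{IX}I=0$, $L_{IX}J=b\,K$. \textbf{Proposition.} Let $(g,I,J,K)$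 be an HKT structure on $M$ with a special homothety $X$ of type $(a,b)$, where $a\ne 0$ and $a\neq b$. Let $\mu=\frac{2}{a(a-b)}\,g(X,X)$ and $U=\{x\in M:\mu(x)\ne0\}$. For a function $f$ that is smooth near the values of $\mu$ on $U$, put on $U$ $$g_f=f'(\mu)\,g+\tfrac12 f''(\mu)\bigl(d\mu^2+(I\,d\mu)^2+(J\,d\mu)^2+(K\,d\mu)^2\bigr).$$ (a) If $f(t)=|t|^k$ with $k\in\mathbb R$, $k\neq 0$, $k\ne b/a$, then on $U$ the tensor $g_f$ is an HKT metric (with the same $I,J,K$) with potential $f(\mu)$, and $X$ is a special homothety of type $(ka,b)$ for it. (b) If $f(t)=\log|t|$ and $b\neq0$, then on $U$ the tensor $g_f$ is an HKT metric (with the same $I,J,K$) with potential $f(\mu)$, and $X$ is a special homothety of type $(0,b)$ for it. Up to homothety these are the only possibilities, in the following sense. Let $f$ be a real function that is smooth near the values of $\mu$ on $U$, and let $h$ be an HKT metric on $U$ (with the same $I,J,K$) with potential $f(\mu)$ for which $X$ is a special homothety of type $(a',b')$. If $m=1$, assume also that $a'\ne b'$. Then $b'=b$, and either $a'=ka$ for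 some $k\ne 0,b/a$, and over each interval $C\subseteq\mu(U)$ the metric $h$ is a non-zero constant multiple of $g_{|t|^k}$ (that is, there is a constant $A\ne0$ with $h=A\,g_{|t|^k}$ on $U\cap\mu^{-1}(C)$); or $a'=0$, $b\neq 0$, and over each interval $C\subseteq\mu(U)$ the metric $h$ is a non-zero constant multiple of $g_{\log|t|}$. -/

import Mathlib

open scoped Manifold ContDiff Bundle

noncomputable section

namespace HKTGeometry

variable (E : Type*) [NormedAddCommGroup E] [NormedSpace ℝ E]
  (M : Type*) [TopologicalSpace M] [ChartedSpace E M]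

/-- Vector fields on `M` (no regularity is built in). -/
abbrev VField := Π x : M, TangentSpace 𝓘(ℝ, E) x

/-- Fields of one-forms on `M` (no regularity is built in). -/
abbrev OneForm := Π x : M, TangentSpace 𝓘(ℝ, E) x →L[ℝ] ℝ

/-- Fields of endomorphisms of the tangent spaces (no regularity is built in). -/
abbrev EndField :=
  Π x : M, TangentSpace 𝓘(ℝ, E) x →L[ℝ] TangentSpace 𝓘(ℝ, E) x

/-- Fields of bilinear forms on the tangent spaces (no regularity is built in). -/
abbrev BilinField :=
  Π x : M, TangentSpace 𝓘(ℝ, E) x →L[ℝ] TangentSpace 𝓘(ℝ, E) x →L[ℝ] ℝ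

/-- Operators sending a vector field `Y` to the field of endomorphisms `v ↦ ∇_v Y`. -/
abbrev ConnectionOp := VField E M → EndField E M

variable {E M}

variable [IsManifold 𝓘(ℝ, E) ∞ M]

/-- The vector field `Y` is differentiable at `x`. -/
def DiffAt (Y : VField E M) (x : M) : Prop :=
  MDifferentiableAt 𝓘(ℝ, E) (𝓘(ℝ, E).prod 𝓘(ℝ, E))
    (fun y ↦ Bundle.TotalSpace.mk' E y (Y y)) x

/-- The vector field `Y` is smooth on `U`. -/
def VField.SmoothOn (Y : VField E M) (U : Set M) : Prop :=
  ContMDiffOn 𝓘(ℝ, E) (𝓘(ℝ, E).prod 𝓘(ℝ, E)) ∞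
    (fun y ↦ Bundle.TotalSpace.mk' E y (Y y)) U

/-- The Lie bracket `[Y, Z]` at `x`. -/
def bracket (Y Z : VField E M) (x : M) : TangentSpace 𝓘(ℝ, E) x :=
  VectorField.mlieBracket 𝓘(ℝ, E) Y Z x

/-- The differential of a real function. -/
def d (φ : M → ℝ) : OneForm E M := fun x ↦ mvfderiv 𝓘(ℝ, E) φ x

/-- The vector field `A Y`. -/
def EndField.app (A : EndField E M) (Y : VField E M) : VField E M := fun x ↦ A x (Y x)

/-- The function `g(Y, Z)`. -/
def BilinField.app (g : BilinField E M) (Y Z : VField E M) : M → ℝ :=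
  fun x ↦ g x (Y x) (Z x)

/-- The field of endomorphisms `A` is smooth on `U`. -/
def EndField.SmoothOn (A : EndField E M) (U : Set M) : Prop :=
  ContMDiffOn 𝓘(ℝ, E) (𝓘(ℝ, E).prod 𝓘(ℝ, E →L[ℝ] E)) ∞
    (fun x ↦ Bundle.TotalSpace.mk' (E →L[ℝ] E)
      (E := fun x : M ↦ TangentSpace 𝓘(ℝ, E) x →L[ℝ] TangentSpace 𝓘(ℝ, E) x) x (A x)) U

/-- The field of bilinear forms `g` is smooth on `U`. -/
def BilinField.SmoothOn (g : BilinField E M) (U : Set M) : Prop :=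
  ContMDiffOn 𝓘(ℝ, E) (𝓘(ℝ, E).prod 𝓘(ℝ, E →L[ℝ] E →L[ℝ] ℝ)) ∞
    (fun x ↦ Bundle.TotalSpace.mk' (E →L[ℝ] E →L[ℝ] ℝ)
      (E := fun x : M ↦ TangentSpace 𝓘(ℝ, E) x →L[ℝ] TangentSpace 𝓘(ℝ, E) x →L[ℝ] ℝ)
      x (g x)) U

/-! ### Hypercomplex structures and HKT structures

Identities between tensor fields on `U` that involve derivatives are expressed at every
`x ∈ U` by evaluating them on all vector fields that are differentiable at `x`. -/

/-- `A` is an integrable complex structure on `U`: a smooth field of endomorphisms with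
`A² = -1` and with vanishing Nijenhuis tensor. -/
structure IsComplexStructureOn (A : EndField E M) (U : Set M) : Prop where
  smooth : A.SmoothOn U
  sq : ∀ x ∈ U, ∀ v, A x (A x v) = -v
  integrable : ∀ x ∈ U, ∀ Y Z : VField E M, DiffAt Y x → DiffAt Z x →
    bracket (A.app Y) (A.app Z) x - A x (bracket (A.app Y) Z x)
      - A x (bracket Y (A.app Z) x) - bracket Y Z x = 0

/-- `I`, `J`, `K` are integrable complex structures on `U` satisfying the quaternion
identities. -/
structure IsHypercomplexOn (I J K : EndField E M) (U : Set M) : Prop where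
  complexI : IsComplexStructureOn I U
  complexJ : IsComplexStructureOn J U
  complexK : IsComplexStructureOn K U
  mul_IJ : ∀ x ∈ U, ∀ v, I x (J x v) = K x v
  mul_JI : ∀ x ∈ U, ∀ v, J x (I x v) = -K x v

/-- `g` is a pseudo-Riemannian metric on `U` (of any signature). -/
structure IsPseudoMetricOn (g : BilinField E M) (U : Set M) : Prop where
  smooth : g.SmoothOn U
  symm : ∀ x ∈ U, ∀ v w, g x v w = g x w v
  nondegenerate : ∀ x ∈ U, ∀ v, (∀ w, g x v w = 0) → v = 0

/-- `g` is Hermitian with respect to `A` on `U`. -/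
def IsHermitianOn (g : BilinField E M) (A : EndField E M) (U : Set M) : Prop :=
  ∀ x ∈ U, ∀ v w, g x (A x v) (A x w) = g x v w

/-- The torsion `T(Y, Z) = ∇_Y Z - ∇_Z Y - [Y, Z]`. -/
def torsion (nabla : ConnectionOp E M) (Y Z : VField E M) : VField E M :=
  fun x ↦ nabla Z x (Y x) - nabla Y x (Z x) - bracket Y Z x

/-- The torsion three-tensor `c(X, Y, Z) = g(X, T(Y, Z))`. -/
def torsionForm (g : BilinField E M) (nabla : ConnectionOp E M) (X Y Z : VField E M) :
    M → ℝ :=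
  g.app X (torsion nabla Y Z)

/-- `nabla` is an HKT connection on `U` for `(g, I, J, K)`: a smooth affine connection that
preserves `g`, `I`, `J` and `K` and has totally skew torsion. -/
structure IsHKTConnectionOn (nabla : ConnectionOp E M) (g : BilinField E M)
    (I J K : EndField E M) (U : Set M) : Prop where
  connection : IsCovariantDerivativeOn E nabla U
  smooth : ContMDiffCovariantDerivativeOn E ∞ nabla U
  metric : ∀ x ∈ U, ∀ Y Z : VField E M, DiffAt Y x → DiffAt Z x → ∀ v,
    d (g.app Y Z) x v = g x (nabla Y x v) (Z x) + g x (Y x) (nabla Z x v)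
  parallelI : ∀ x ∈ U, ∀ Y : VField E M, DiffAt Y x → ∀ v,
    nabla (I.app Y) x v = I x (nabla Y x v)
  parallelJ : ∀ x ∈ U, ∀ Y : VField E M, DiffAt Y x → ∀ v,
    nabla (J.app Y) x v = J x (nabla Y x v)
  parallelK : ∀ x ∈ U, ∀ Y : VField E M, DiffAt Y x → ∀ v,
    nabla (K.app Y) x v = K x (nabla Y x v)
  skew_left : ∀ x ∈ U, ∀ X Y Z : VField E M, DiffAt X x → DiffAt Y x → DiffAt Z x →
    torsionForm g nabla X Y Z x = -torsionForm g nabla Y X Z x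
  skew_right : ∀ x ∈ U, ∀ X Y Z : VField E M, DiffAt X x → DiffAt Y x → DiffAt Z x →
    torsionForm g nabla X Y Z x = -torsionForm g nabla X Z Y x

/-- `(g, I, J, K)` is an HKT structure on `U`. -/
structure IsHKTOn (g : BilinField E M) (I J K : EndField E M) (U : Set M) : Prop where
  hypercomplex : IsHypercomplexOn I J K U
  metric : IsPseudoMetricOn g U
  hermitianI : IsHermitianOn g I U
  hermitianJ : IsHermitianOn g J U
  hermitianK : IsHermitianOn g K U
  exists_connection : ∃ nabla : ConnectionOp E M, IsHKTConnectionOn nabla g I J K U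

/-! ### Potentials -/

/-- The one-form `Aβ = β(-A ·)`. -/
def twist (A : EndField E M) (β : OneForm E M) : OneForm E M :=
  fun x ↦ -((β x).comp (A x))

/-- The exterior derivative of a one-form,
`(dβ)(Y, Z) = Y(β(Z)) - Z(β(Y)) - β([Y, Z])`. -/
def extD (β : OneForm E M) (Y Z : VField E M) (x : M) : ℝ :=
  d (fun y ↦ β y (Z y)) x (Y x) - d (fun y ↦ β y (Y y)) x (Z x) - β x (bracket Y Z x)

/-- `d_A μ = A dμ` for a function `μ`. -/
def dTwist₀ (A : EndField E M) (μ : M → ℝ) : OneForm E M := twist A (d μ)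

/-- `d_A β = -A d (A β)` for a one-form `β`. Here `A` acts on the two-form `ω = d (A β)` by
`(A ω)(Y, Z) = ω(-A Y, -A Z) = ω(A Y, A Z)`. -/
def dTwist₁ (A : EndField E M) (β : OneForm E M) (Y Z : VField E M) (x : M) : ℝ :=
  -extD (twist A β) (A.app Y) (A.app Z) x

/-- `F_A = ½ (d d_A + d_B d_C) μ` on `U`, where `F_A(Y, Z) = g(A Y, Z)`. -/
def PotentialEqOn (μ : M → ℝ) (g : BilinField E M) (A B C : EndField E M) (U : Set M) :
    Prop :=
  ∀ x ∈ U, ∀ Y Z : VField E M, DiffAt Y x → DiffAt Z x →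
    g x (A x (Y x)) (Z x) =
      (1 / 2 : ℝ) * (extD (dTwist₀ A μ) Y Z x + dTwist₁ B (dTwist₀ C μ) Y Z x)

/-- `μ` is a potential on `U` for the HKT structure `(g, I, J, K)`. -/
structure IsPotentialOn (μ : M → ℝ) (g : BilinField E M) (I J K : EndField E M)
    (U : Set M) : Prop where
  smooth : ContMDiffOn 𝓘(ℝ, E) 𝓘(ℝ, ℝ) ∞ μ U
  eqI : PotentialEqOn μ g I J K U
  eqJ : PotentialEqOn μ g J K I U
  eqK : PotentialEqOn μ g K I J U

/-! ### Special homotheties -/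

/-- The Lie derivative `(L_V g)(Y, Z)` at `x`. -/
def lieBilin (V : VField E M) (g : BilinField E M) (Y Z : VField E M) (x : M) : ℝ :=
  d (g.app Y Z) x (V x) - g x (bracket V Y x) (Z x) - g x (Y x) (bracket V Z x)

/-- The Lie derivative `(L_V A) Y` at `x`. -/
def lieEnd (V : VField E M) (A : EndField E M) (Y : VField E M) (x : M) :
    TangentSpace 𝓘(ℝ, E) x :=
  bracket V (A.app Y) x - A x (bracket V Y x)

/-- `L_V g = r g` on `U`. -/
def LieBilinEqOn (V : VField E M) (g : BilinField E M) (r : ℝ) (U : Set M) : Prop :=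
  ∀ x ∈ U, ∀ Y Z : VField E M, DiffAt Y x → DiffAt Z x →
    lieBilin V g Y Z x = r * g x (Y x) (Z x)

/-- `L_V A = r B` on `U`. -/
def LieEndEqOn (V : VField E M) (A : EndField E M) (r : ℝ) (B : EndField E M)
    (U : Set M) : Prop :=
  ∀ x ∈ U, ∀ Y : VField E M, DiffAt Y x → lieEnd V A Y x = r • B x (Y x)

/-- `X` is a special homothety of type `(a, b)` on `U` for `(g, I, J, K)`. -/
structure IsSpecialHomothetyOn (X : VField E M) (g : BilinField E M)
    (I J K : EndField E M) (a b : ℝ) (U : Set M) : Prop where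
  smooth : X.SmoothOn U
  lie_X_g : LieBilinEqOn X g a U
  lie_IX_g : LieBilinEqOn (I.app X) g 0 U
  lie_JX_g : LieBilinEqOn (J.app X) g 0 U
  lie_KX_g : LieBilinEqOn (K.app X) g 0 U
  lie_IX_I : LieEndEqOn (I.app X) I 0 I U
  lie_JX_J : LieEndEqOn (J.app X) J 0 J U
  lie_KX_K : LieEndEqOn (K.app X) K 0 K U
  lie_IX_J : LieEndEqOn (I.app X) J b K U
  lie_JX_K : LieEndEqOn (J.app X) K b I U
  lie_KX_I : LieEndEqOn (K.app X) I b J U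

/-- The function `μ = 2 / (a (a - b)) · g(X, X)`. -/
def potentialOf (X : VField E M) (g : BilinField E M) (a b : ℝ) : M → ℝ :=
  fun x ↦ 2 / (a * (a - b)) * g x (X x) (X x)

/-- The square `β ⊗ β` of a one-form. -/
def OneForm.square (β : OneForm E M) : BilinField E M := fun x ↦ (β x).smulRight (β x)

/-- `(d^ℍ μ)² = dμ² + (I dμ)² + (J dμ)² + (K dμ)²`. -/
def dHSquare (I J K : EndField E M) (μ : M → ℝ) : BilinField E M := fun x ↦
  OneForm.square (d μ) x + OneForm.square (twist I (d μ)) x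
    + OneForm.square (twist J (d μ)) x + OneForm.square (twist K (d μ)) x

/-- The tensor `g_f = f'(μ) g + ½ f''(μ) (d^ℍ μ)²`. -/
def transformed (g : BilinField E M) (I J K : EndField E M) (μ : M → ℝ) (f : ℝ → ℝ) :
    BilinField E M := fun x ↦
  deriv f (μ x) • g x + ((1 / 2 : ℝ) * deriv (deriv f) (μ x)) • dHSquare I J K μ x

/-- `φ(μ)` is a potential on `U` for the HKT metric `h`, and `X` is a special homothety of
type `(a, b)` for `h` on `U`. -/
structure HasPotentialAndHomothetyOn (h : BilinField E M) (I J K : EndField E M)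
    (X : VField E M) (φ : M → ℝ) (a b : ℝ) (U : Set M) : Prop where
  hkt : IsHKTOn h I J K U
  potential : IsPotentialOn φ h I J K U
  homothety : IsSpecialHomothetyOn X h I J K a b U

/-- `h` is a nonzero constant multiple of `h₀` over each interval `C` of values of `μ`
on `U`. -/
def HomotheticOverIntervals (h h₀ : BilinField E M) (μ : M → ℝ) (U : Set M) : Prop :=
  ∀ C ⊆ μ '' U, IsPreconnected C → ∃ A : ℝ, A ≠ 0 ∧ ∀ x ∈ U, μ x ∈ C → h x = A • h₀ x

end HKTGeometry

end

open HKTGeometry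

/-!
Write `c = 2 / (a - b)` and `X♭ = g(X, ·)`, and let `∇` be the HKT connection of `g` and `T` its
torsion.

*Consequences of the homothety.* Since `T` is totally skew, `L_V g` is twice the symmetric part of
`g(∇V, ·)`. Applied to `X`, `I X`, `J X`, `K X` the homothety equations say that `∇X - a/2` is skew
and anticommutes with `I`, `J` and `K = I J`, so `∇X = a/2`. Hence `dμ = c X♭`, the form `X♭` is
closed, and so `T(X, ·) = 0`. The equations for `L_{IX} I` and `L_{IX} J` become commutation rules
between `T(I X, ·)` and `I`, `J`, `K`. All of this is algebra at a point, which `HomothetyModel`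
records.

*The metrics `g_f`.* By `dμ = c X♭` the tensor `g_f` has the form
`p g + r ∑ (Aᵢ X)♭ ⊗ (Aᵢ X)♭`, the sum being over `Aᵢ = 1, I, J, K`, where `dp = (a - b) r X♭` and
`dr = s X♭`. For any such `p` and `r`, the identities of `HomothetyModel` imply the following.
* A function `φ` with `dφ = c p X♭` is a potential (`potentialEqOn_deformed`); this applies to
  `φ = f(μ)`.
* The tensor is an HKT metric wherever it is nondegenerate, that is, where `p` and
  `p + r g(X, X)` do not vanish (`isHKTOn_deformed`). Its connection is written down explicitly:
  `preChange` is the `g`-dual of `g'(∇' - ∇, ·)`, and its three properties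
  `preChange_comm`, `preChange_metric` and `preChange_skew` say that the new connection preserves
  the complex structures and the new metric `g'` and has skew torsion.
* The fields `I X`, `J X`, `K X` are Killing, and `L_X g' = a' g'` is a pair of linear
  equations in `p`, `r` and `s` (`lieBilin_X_deformed`).

For `f' = c' |t| ^ k / t` the last equations hold with `a' = k a`, and
`p + r g(X, X) = f'(μ) (k a - b) / (a - b)`. This gives the existence statements.

*Uniqueness.* A metric is determined by its potential, so `h = g_f` on `U`. In dimension greater
than four, evaluating `L_X h = a' h` on a vector orthogonal to `X`, `I X`, `J X`, `K X` gives
`t f'' = (k - 1) f'` with `k = a' / a`. In dimension four these vectors are an orthogonal basis,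
`h` is a multiple `w(μ) g`, and evaluating on `X` gives `t w' = (k - 1) w`. Either way `f` can be
compared on each interval with the solution `|t| ^ k` or, for `k = 0`, `log |t|`.
-/

set_option linter.unusedSectionVars false

noncomputable section

namespace HKTGeometry

open scoped Topology

/-! ### Smooth fields -/

section

variable {E : Type*} [NormedAddCommGroup E] [NormedSpace ℝ E]
  {M : Type*} [TopologicalSpace M] [ChartedSpace E M]

/-- A field of linear maps on a finite-dimensional space is smooth if its values on each vector
are. -/
lemma contMDiffAt_clm_of_apply [FiniteDimensional ℝ E] {F : Type*} [NormedAddCommGroup F]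
    [NormedSpace ℝ F] {f : M → E →L[ℝ] F} {x : M}
    (h : ∀ v, ContMDiffAt 𝓘(ℝ, E) 𝓘(ℝ, F) ∞ (fun y ↦ f y v) x) :
    ContMDiffAt 𝓘(ℝ, E) 𝓘(ℝ, E →L[ℝ] F) ∞ f x := by
  have hd : Module.finrank ℝ E = Module.finrank ℝ (Fin (Module.finrank ℝ E) → ℝ) :=
    (Module.finrank_fin_fun ℝ).symm
  let e₁ := ContinuousLinearEquiv.ofFinrankEq hd
  let e₂ := (e₁.arrowCongr (1 : F ≃L[ℝ] F)).trans
    (ContinuousLinearEquiv.piRing (Fin (Module.finrank ℝ E)))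
  rw [← Function.id_comp f, ← e₂.symm_comp_self]
  exact e₂.symm.contDiff.contMDiff.contMDiffAt.comp x (contMDiffAt_pi_space.2 fun i ↦ h _)

variable [IsManifold 𝓘(ℝ, E) ∞ M]

/-- The vector field `Y` is smooth at `x`. -/
def SmAt (Y : VField E M) (x : M) : Prop :=
  ContMDiffAt 𝓘(ℝ, E) (𝓘(ℝ, E).prod 𝓘(ℝ, E)) ∞ (fun y ↦ Bundle.TotalSpace.mk' E y (Y y)) x

variable (E) in
/-- The function `φ` is smooth at `x`. -/
abbrev FSmAt (φ : M → ℝ) (x : M) : Prop := ContMDiffAt 𝓘(ℝ, E) 𝓘(ℝ, ℝ) ∞ φ x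

lemma BilinField.SmoothOn.fsmAt_app {g : BilinField E M} {U : Set M} (hg : g.SmoothOn U)
    (hU : IsOpen U) {x : M} (hx : x ∈ U) {Y Z : VField E M} (hY : SmAt Y x) (hZ : SmAt Z x) :
    FSmAt E (g.app Y Z) x := by
  have := ContMDiffAt.clm_bundle_apply₂ (E₃ := Bundle.Trivial M ℝ)
    ((hg x hx).contMDiffAt (hU.mem_nhds hx)) hY hZ
  exact (Bundle.contMDiffAt_totalSpace.1 this).2

lemma BilinField.SmoothOn.mdifferentiableAt_app {g : BilinField E M} {U : Set M}
    (hg : g.SmoothOn U) (hU : IsOpen U)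
    {x : M} (hx : x ∈ U) {Y Z : VField E M} (hY : DiffAt Y x) (hZ : DiffAt Z x) :
    MDifferentiableAt 𝓘(ℝ, E) 𝓘(ℝ, ℝ) (g.app Y Z) x := by
  have := MDifferentiableAt.clm_bundle_apply₂ (E₃ := Bundle.Trivial M ℝ)
    (((hg x hx).contMDiffAt (hU.mem_nhds hx)).mdifferentiableAt (by simp)) hY hZ
  exact ((mdifferentiableAt_totalSpace _ _).1 this).2

lemma EndField.SmoothOn.smAt_app {A : EndField E M} {U : Set M} (hA : A.SmoothOn U)
    (hU : IsOpen U) {x : M} (hx : x ∈ U) {Y : VField E M} (hY : SmAt Y x) : SmAt (A.app Y) x :=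
  ContMDiffAt.clm_bundle_apply ((hA x hx).contMDiffAt (hU.mem_nhds hx)) hY

lemma EndField.SmoothOn.diffAt_app {A : EndField E M} {U : Set M} (hA : A.SmoothOn U)
    (hU : IsOpen U) {x : M} (hx : x ∈ U) {Y : VField E M} (hY : DiffAt Y x) :
    DiffAt (A.app Y) x :=
  MDifferentiableAt.clm_bundle_apply
    (((hA x hx).contMDiffAt (hU.mem_nhds hx)).mdifferentiableAt (by simp)) hY

lemma SmAt.diffAt {Y : VField E M} {x : M} (h : SmAt Y x) : DiffAt Y x :=
  ContMDiffAt.mdifferentiableAt h (by simp)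

lemma SmAt.add {Y Z : VField E M} {x : M} (hY : SmAt Y x) (hZ : SmAt Z x) :
    SmAt (fun y ↦ Y y + Z y) x := ContMDiffAt.add_section hY hZ

lemma SmAt.sub {Y Z : VField E M} {x : M} (hY : SmAt Y x) (hZ : SmAt Z x) :
    SmAt (fun y ↦ Y y - Z y) x := ContMDiffAt.sub_section hY hZ

lemma SmAt.smul {φ : M → ℝ} {Y : VField E M} {x : M} (hφ : FSmAt E φ x) (hY : SmAt Y x) :
    SmAt (fun y ↦ φ y • Y y) x := ContMDiffAt.smul_section hφ hY

/-- A tangent vector extended to a vector field. -/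
def extend {x : M} (v : TangentSpace 𝓘(ℝ, E) x) : VField E M := FiberBundle.extend E v

@[simp] lemma extend_self {x : M} (v : TangentSpace 𝓘(ℝ, E) x) : extend v x = v := by simp [extend]

lemma diffAt_extend [FiniteDimensional ℝ E] {x : M} (v : TangentSpace 𝓘(ℝ, E) x) :
    DiffAt (extend v) x :=
  FiberBundle.mdifferentiableAt_extend _ _ _

variable [FiniteDimensional ℝ E]

/-- A field of linear maps out of the tangent spaces is smooth at a point if it sends every vector
field that is smooth at the point to a section that is smooth at the point. -/
lemma contMDiffAt_hom_of_apply {F : Type*} [NormedAddCommGroup F] [NormedSpace ℝ F]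
    {V : M → Type*} [TopologicalSpace (Bundle.TotalSpace F V)] [∀ x, AddCommGroup (V x)]
    [∀ x, Module ℝ (V x)] [∀ x, TopologicalSpace (V x)] [∀ x, IsTopologicalAddGroup (V x)]
    [∀ x, ContinuousSMul ℝ (V x)] [FiberBundle F V] [VectorBundle ℝ F V]
    {A : Π x : M, TangentSpace 𝓘(ℝ, E) x →L[ℝ] V x} {x : M}
    (h : ∀ Y : VField E M, SmAt Y x →
      ContMDiffAt 𝓘(ℝ, E) (𝓘(ℝ, E).prod 𝓘(ℝ, F)) ∞
        (fun y ↦ Bundle.TotalSpace.mk' F (E := V) y (A y (Y y))) x) :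
    ContMDiffAt 𝓘(ℝ, E) (𝓘(ℝ, E).prod 𝓘(ℝ, E →L[ℝ] F)) ∞
      (fun y ↦ Bundle.TotalSpace.mk' (E →L[ℝ] F)
        (E := fun y : M ↦ TangentSpace 𝓘(ℝ, E) y →L[ℝ] V y) y (A y)) x := by
  rw [contMDiffAt_hom_bundle]
  refine ⟨contMDiffAt_id, contMDiffAt_clm_of_apply fun v ↦ ?_⟩
  set e := trivializationAt E (TangentSpace 𝓘(ℝ, E) : M → Type _) x
  have hx : x ∈ e.baseSet := FiberBundle.mem_baseSet_trivializationAt' x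
  have hY : SmAt (fun y : M ↦ e.symm y v) x := by
    refine Bundle.contMDiffAt_totalSpace.2
      ⟨contMDiffAt_id, (contMDiffAt_const (c := v)).congr_of_eventuallyEq ?_⟩
    filter_upwards [e.open_baseSet.mem_nhds hx] with y hy
    simpa using! congrArg Prod.snd (e.apply_mk_symm hy v)
  have h' := (Bundle.contMDiffAt_totalSpace.1 (h _ hY)).2
  refine h'.congr_of_eventuallyEq ?_
  have hx' : x ∈ (trivializationAt F V x).baseSet := FiberBundle.mem_baseSet_trivializationAt' x
  filter_upwards [(trivializationAt F V x).open_baseSet.mem_nhds hx',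
    e.open_baseSet.mem_nhds hx] with y hy hy'
  simp [ContinuousLinearMap.inCoordinates, Bundle.Trivialization.coe_linearMapAt_of_mem _ hy, e,
    Bundle.Trivialization.symmL_apply _ hy']

lemma BilinField.smoothOn_of_app {g : BilinField E M} {U : Set M}
    (h : ∀ x ∈ U, ∀ Y Z, SmAt Y x → SmAt Z x → FSmAt E (g.app Y Z) x) : g.SmoothOn U := by
  intro x hx
  refine ContMDiffAt.contMDiffWithinAt ?_
  refine contMDiffAt_hom_of_apply (F := E →L[ℝ] ℝ)
    (V := fun y : M ↦ TangentSpace 𝓘(ℝ, E) y →L[ℝ] ℝ) fun Y hY ↦ ?_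
  refine contMDiffAt_hom_of_apply (F := ℝ) (V := Bundle.Trivial M ℝ) fun Z hZ ↦ ?_
  exact Bundle.contMDiffAt_totalSpace.2 ⟨contMDiffAt_id, h x hx Y Z hY hZ⟩

lemma smAt_bracket {Y Z : VField E M} {x : M} (hY : SmAt Y x) (hZ : SmAt Z x) :
    SmAt (bracket Y Z) x := by
  have := FiniteDimensional.complete ℝ E
  have : IsManifold 𝓘(ℝ, E) (minSmoothness ℝ 2) M :=
    by rw [minSmoothness_of_isRCLikeNormedField]; infer_instance
  have : IsManifold 𝓘(ℝ, E) (minSmoothness ℝ 3) M :=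
    by rw [minSmoothness_of_isRCLikeNormedField]; infer_instance
  have : IsManifold 𝓘(ℝ, E) (((⊤ : ℕ∞) : ℕ∞ω) + 1) M := by simpa using ‹IsManifold 𝓘(ℝ, E) ∞ M›
  exact ContMDiffAt.mlieBracket_vectorField (m := ⊤) (n := ⊤) hY hZ (by simp)

/-- A vector field that is smooth on an open set agrees near each of its points with a globally
smooth one. -/
lemma exists_global [T2Space M] {Y : VField E M} {U : Set M} (hU : IsOpen U) (hY : Y.SmoothOn U)
    {x : M} (hx : x ∈ U) :
    ∃ Y' : VField E M, Y'.SmoothOn Set.univ ∧ ∀ᶠ y in 𝓝 x, Y' y = Y y := by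
  obtain ⟨f, -, hf⟩ := (SmoothBumpFunction.nhds_basis_tsupport (I := 𝓘(ℝ, E)) x).mem_iff.1
    (hU.mem_nhds hx)
  refine ⟨fun y ↦ f y • Y y, ?_, ?_⟩
  · exact (ContMDiffOn.smul_section_of_tsupport f.contMDiff.contMDiffOn hU hf hY).contMDiffOn
  · filter_upwards [f.eventuallyEq_one] with y hy
    simp [hy]

end

/-! ### Differentials of functions -/

section

variable {E : Type*} [NormedAddCommGroup E] [NormedSpace ℝ E]
  {M : Type*} [TopologicalSpace M] [ChartedSpace E M]

lemma d_congr {φ ψ : M → ℝ} {x : M} (h : φ =ᶠ[𝓝 x] ψ) : d (E := E) φ x = d ψ x := by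
  simp only [d, mvfderiv]
  rw [h.mfderiv_eq]
  rfl

lemma d_comp {φ : M → ℝ} {f : ℝ → ℝ} {x : M} (hf : DifferentiableAt ℝ f (φ x))
    (hφ : MDifferentiableAt 𝓘(ℝ, E) 𝓘(ℝ, ℝ) φ x) (v : TangentSpace 𝓘(ℝ, E) x) :
    d (E := E) (fun y ↦ f (φ y)) x v = deriv f (φ x) * d φ x v := by
  have h1 : mfderiv 𝓘(ℝ, E) 𝓘(ℝ, ℝ) (f ∘ φ) x v =
      fderiv ℝ f (φ x) (mfderiv 𝓘(ℝ, E) 𝓘(ℝ, ℝ) φ x v) := by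
    rw [mfderiv_comp_apply x hf.mdifferentiableAt hφ v, mfderiv_eq_fderiv]
    rfl
  refine h1.trans ((fderiv_eq_smul_deriv (𝕜 := ℝ) (f := f) (x := φ x) _).trans ?_)
  exact mul_comm _ _

/-- The function `dG(W)` in the chart at `x`: the chart expression of `G` is differentiated in the
direction of the chart expression of `W`. -/
lemma d_comp_symm [IsManifold 𝓘(ℝ, E) ∞ M] {G : M → ℝ} {x : M} {e : E}
    (he : e ∈ (extChartAt 𝓘(ℝ, E) x).target)
    (hG : MDifferentiableAt 𝓘(ℝ, E) 𝓘(ℝ, ℝ) G ((extChartAt 𝓘(ℝ, E) x).symm e)) (W : VField E M) :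
    d (E := E) G ((extChartAt 𝓘(ℝ, E) x).symm e) (W ((extChartAt 𝓘(ℝ, E) x).symm e)) =
      fderiv ℝ (G ∘ (extChartAt 𝓘(ℝ, E) x).symm) e
        (VectorField.mpullbackWithin 𝓘(ℝ, E) 𝓘(ℝ, E) (extChartAt 𝓘(ℝ, E) x).symm W
          Set.univ e) := by
  have hs := (mdifferentiableOn_extChartAt_symm (I := 𝓘(ℝ, E)) (x := x)) e he
  have hs' : MDifferentiableAt 𝓘(ℝ, E) 𝓘(ℝ, E) (extChartAt 𝓘(ℝ, E) x).symm e :=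
    hs.mdifferentiableAt ((isOpen_extChartAt_target x).mem_nhds he)
  rw [← mfderiv_eq_fderiv, mfderiv_comp e hG hs']
  have hi := isInvertible_mfderivWithin_extChartAt_symm (I := 𝓘(ℝ, E)) he
  simp only [VectorField.mpullbackWithin_apply, ModelWithCorners.range_eq_univ,
    mfderivWithin_univ] at hi ⊢
  refine Eq.symm ?_
  change mfderiv 𝓘(ℝ, E) 𝓘(ℝ, ℝ) G _ (mfderiv 𝓘(ℝ, E) 𝓘(ℝ, E) (extChartAt 𝓘(ℝ, E) x).symm e
    ((mfderiv 𝓘(ℝ, E) 𝓘(ℝ, E) (extChartAt 𝓘(ℝ, E) x).symm e).inverse _)) = _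
  rw [hi.self_apply_inverse]
  rfl

lemma mdiffAt_mul {φ ψ : M → ℝ} {x : M} (hφ : MDifferentiableAt 𝓘(ℝ, E) 𝓘(ℝ, ℝ) φ x)
    (hψ : MDifferentiableAt 𝓘(ℝ, E) 𝓘(ℝ, ℝ) ψ x) :
    MDifferentiableAt 𝓘(ℝ, E) 𝓘(ℝ, ℝ) (fun y ↦ φ y * ψ y) x := hφ.mul hψ

lemma mdiffAt_add {φ ψ : M → ℝ} {x : M} (hφ : MDifferentiableAt 𝓘(ℝ, E) 𝓘(ℝ, ℝ) φ x)
    (hψ : MDifferentiableAt 𝓘(ℝ, E) 𝓘(ℝ, ℝ) ψ x) :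
    MDifferentiableAt 𝓘(ℝ, E) 𝓘(ℝ, ℝ) (fun y ↦ φ y + ψ y) x := hφ.add hψ

lemma d_mul {φ ψ : M → ℝ} {x : M} (hφ : MDifferentiableAt 𝓘(ℝ, E) 𝓘(ℝ, ℝ) φ x)
    (hψ : MDifferentiableAt 𝓘(ℝ, E) 𝓘(ℝ, ℝ) ψ x) (v : TangentSpace 𝓘(ℝ, E) x) :
    d (E := E) (fun y ↦ φ y * ψ y) x v = d φ x v * ψ x + φ x * d ψ x v := by
  simp only [d]
  rw [mvfderiv_fun_mul hφ hψ]
  simp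
  ring

lemma d_add {φ ψ : M → ℝ} {x : M} (hφ : MDifferentiableAt 𝓘(ℝ, E) 𝓘(ℝ, ℝ) φ x)
    (hψ : MDifferentiableAt 𝓘(ℝ, E) 𝓘(ℝ, ℝ) ψ x) (v : TangentSpace 𝓘(ℝ, E) x) :
    d (E := E) (fun y ↦ φ y + ψ y) x v = d φ x v + d ψ x v := by
  simp only [d]
  rw [mvfderiv_fun_add hφ hψ]
  simp

lemma d_const_mul {φ : M → ℝ} {x : M} (c : ℝ)
    (hφ : MDifferentiableAt 𝓘(ℝ, E) 𝓘(ℝ, ℝ) φ x) (v : TangentSpace 𝓘(ℝ, E) x) :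
    d (E := E) (fun y ↦ c * φ y) x v = c * d φ x v := by
  rw [d_mul mdifferentiableAt_const hφ]
  simp [d, mvfderiv_const]

variable [IsManifold 𝓘(ℝ, E) ∞ M]

/-- The identity `d² = 0`. In a chart it is the symmetry of the second derivative. -/
lemma extD_d [CompleteSpace E] {φ : M → ℝ} {x : M} (hφ : FSmAt E φ x) {Y Z : VField E M}
    (hY : DiffAt Y x) (hZ : DiffAt Z x) : extD (d φ) Y Z x = 0 := by
  set c := extChartAt 𝓘(ℝ, E) x with hc
  have hx : c x ∈ c.target := mem_extChartAt_target x
  have hcx : c.symm (c x) = x := extChartAt_to_inv x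
  set F : E → ℝ := φ ∘ c.symm with hF
  have hFs : ContDiffAt ℝ ∞ F (c x) := by
    rw [← contMDiffAt_iff_contDiffAt]
    refine ContMDiffAt.comp (c x) (by rwa [hcx]) ?_
    exact (contMDiffOn_extChartAt_symm x _ hx).contMDiffAt
      ((isOpen_extChartAt_target x).mem_nhds hx)
  -- The expressions of `φ` and of a vector field `W` in the chart are `F` and `H W`.
  let H (W : VField E M) : E → E :=
    VectorField.mpullbackWithin 𝓘(ℝ, E) 𝓘(ℝ, E) c.symm W Set.univ
  have hH {W : VField E M} (hW : DiffAt W x) : DifferentiableAt ℝ (H W) (c x) := by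
    have := MDifferentiableWithinAt.differentiableWithinAt_mpullbackWithin_vectorField
      (s := Set.univ) (MDifferentiableAt.mdifferentiableWithinAt hW)
    rw [Set.preimage_univ, Set.univ_inter, ModelWithCorners.range_eq_univ] at this
    exact differentiableWithinAt_univ.1 this
  have hφd : ∀ᶠ y in 𝓝 x, MDifferentiableAt 𝓘(ℝ, E) 𝓘(ℝ, ℝ) φ y := by
    filter_upwards [(contMDiffAt_iff_contMDiffAt_nhds (by simp)).1
      (hφ.of_le (m := 1) (by simp))] with y hy
    exact hy.mdifferentiableAt (by simp)
  have hcont : ContinuousAt c.symm (c x) := continuousAt_extChartAt_symm x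
  have hG {W : VField E M} (hW : DiffAt W x) :
      (fun y ↦ d φ y (W y)) ∘ c.symm =ᶠ[𝓝 (c x)] fun e ↦ fderiv ℝ F e (H W e) := by
    have := hcont.eventually (p := fun y ↦ MDifferentiableAt 𝓘(ℝ, E) 𝓘(ℝ, ℝ) φ y) (by rwa [hcx])
    filter_upwards [this, (isOpen_extChartAt_target x).mem_nhds hx] with e he he'
    exact d_comp_symm he' he W
  have hF' : DifferentiableAt ℝ (fderiv ℝ F) (c x) :=
    (hFs.fderiv_right (m := 1) (by norm_cast)).differentiableAt (by simp)
  have hGd {W : VField E M} (hW : DiffAt W x) :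
      MDifferentiableAt 𝓘(ℝ, E) 𝓘(ℝ, ℝ) (fun y ↦ d φ y (W y)) x := by
    have h1 : DifferentiableAt ℝ ((fun y ↦ d φ y (W y)) ∘ c.symm) (c x) :=
      (hF'.clm_apply (hH hW)).congr_of_eventuallyEq (hG hW)
    have h2 := h1.mdifferentiableAt.comp x
      (mdifferentiableAt_extChartAt (I := 𝓘(ℝ, E)) (mem_chart_source E x))
    refine h2.congr_of_eventuallyEq ?_
    filter_upwards [extChartAt_source_mem_nhds (I := 𝓘(ℝ, E)) x] with y hy
    change (fun y ↦ d φ y (W y)) y = (fun y ↦ d φ y (W y)) (c.symm (c y))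
    rw [c.left_inv hy]
  have hd {W V : VField E M} (hW : DiffAt W x) : d (E := E) (fun y ↦ d φ y (W y)) x (V x) =
      fderiv ℝ (fderiv ℝ F) (c x) (H V (c x)) (H W (c x)) +
        fderiv ℝ F (c x) (fderiv ℝ (H W) (c x) (H V (c x))) := by
    have := d_comp_symm (x := x) hx (by rw [hcx]; exact hGd hW) V
    rw [← hc, (hG hW).fderiv_eq, fderiv_clm_apply hF' (hH hW)] at this
    rw [hcx] at this
    rw [this]
    exact add_comm _ _
  have hb : d φ x (bracket Y Z x) = fderiv ℝ F (c x)
      (fderiv ℝ (H Z) (c x) (H Y (c x)) - fderiv ℝ (H Y) (c x) (H Z (c x))) := by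
    have h1 : d (E := E) φ x = d (F ∘ c) x := d_congr <| by
      filter_upwards [extChartAt_source_mem_nhds (I := 𝓘(ℝ, E)) x] with y hy
      simp only [hF, hc, Function.comp_apply, (extChartAt 𝓘(ℝ, E) x).left_inv hy]
    have hi := isInvertible_mfderiv_extChartAt (I := 𝓘(ℝ, E))
      (mem_extChartAt_source (I := 𝓘(ℝ, E)) x)
    rw [h1, bracket, VectorField.mlieBracket, VectorField.mlieBracketWithin_apply]
    have h2 := fun v ↦ mfderiv_comp_apply x (hFs.differentiableAt (by simp)).mdifferentiableAt
      (mdifferentiableAt_extChartAt (I := 𝓘(ℝ, E)) (mem_chart_source E x)) v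
    refine (h2 _).trans ?_
    rw [mfderiv_eq_fderiv]
    refine (congrArg (fderiv ℝ F (c x)) (hi.self_apply_inverse _)).trans ?_
    simp only [Set.preimage_univ, Set.univ_inter, ModelWithCorners.range_eq_univ]
    exact congrArg (fderiv ℝ F (c x)) (congrFun
      (VectorField.lieBracketWithin_univ (𝕜 := ℝ) (V := H Y) (W := H Z)) (c x))
  rw [extD, hd hZ, hd hY, hb, map_sub]
  have := (hFs.isSymmSndFDerivAt (by simp; norm_cast)).eq (H Y (c x)) (H Z (c x))
  rw [this]
  ring

end

/-! ### Algebra at a point -/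

section Pointwise

variable {V : Type*} [AddCommGroup V] [Module ℝ V] [TopologicalSpace V] [IsTopologicalAddGroup V]
  [ContinuousSMul ℝ V]
  {g : V →L[ℝ] V →L[ℝ] ℝ} {I J K : V →L[ℝ] V}

/-- The algebraic identities between a nondegenerate form `g` and the complex structures `I`, `J`,
`K` for which it is Hermitian. -/
structure HyperHermitian (g : V →L[ℝ] V →L[ℝ] ℝ) (I J K : V →L[ℝ] V) : Prop where
  symm : ∀ u v, g u v = g v u
  nondeg : ∀ u, (∀ v, g u v = 0) → u = 0
  II : ∀ v, I (I v) = -v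
  JJ : ∀ v, J (J v) = -v
  KK : ∀ v, K (K v) = -v
  IJ : ∀ v, I (J v) = K v
  JI : ∀ v, J (I v) = -K v
  JK : ∀ v, J (K v) = I v
  KJ : ∀ v, K (J v) = -I v
  KI : ∀ v, K (I v) = J v
  IK : ∀ v, I (K v) = -J v
  skewI : ∀ u v, g u (I v) = -g (I u) v
  skewJ : ∀ u v, g u (J v) = -g (J u) v
  skewK : ∀ u v, g u (K v) = -g (K u) v

/-- All notions below are invariant under the cyclic permutation of `I`, `J`, `K`, so that
statements about `J` and `K` follow from those about `I`. -/
lemma HyperHermitian.rotate (h : HyperHermitian g I J K) : HyperHermitian g J K I where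
  symm := h.symm
  nondeg := h.nondeg
  II := h.JJ
  JJ := h.KK
  KK := h.II
  IJ := h.JK
  JI := h.KJ
  JK := h.KI
  KJ := h.IK
  KI := h.IJ
  IK := h.JI
  skewI := h.skewJ
  skewJ := h.skewK
  skewK := h.skewI

/-- If the endomorphism `P` satisfies the infinitesimal homothety equations, it is a multiple of
the identity: `P - a/2` is skew and anticommutes with `I` and `J`, hence commutes with `K = I J`,
with which it also anticommutes. -/
lemma HyperHermitian.eq_half_smul (h : HyperHermitian g I J K) {P : V →L[ℝ] V} {a : ℝ}
    (h0 : ∀ u v, g (P u) v + g u (P v) = a * g u v)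
    (hI : ∀ u v, g (I (P u)) v + g u (I (P v)) = 0)
    (hJ : ∀ u v, g (J (P u)) v + g u (J (P v)) = 0)
    (hK : ∀ u v, g (K (P u)) v + g u (K (P v)) = 0) (u : V) : P u = (a / 2) • u := by
  set B : V → V → ℝ := fun u v ↦ g (P u) v - a / 2 * g u v with hB
  have key : ∀ A : V →L[ℝ] V, (∀ u v, g u (A v) = -g (A u) v) →
      (∀ u v, g (A (P u)) v + g u (A (P v)) = 0) → ∀ u v, B (A u) v = B u (A v) := by
    intro A hA hP u v
    have h1 := h0 (A u) v
    have h2 := hP u v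
    simp only [hB, hA] at h2 ⊢
    linarith
  have kI := key I h.skewI hI
  have kJ := key J h.skewJ hJ
  have kK := key K h.skewK hK
  rw [← sub_eq_zero]
  refine h.nondeg _ fun v ↦ ?_
  have hv : v = -K (K v) := by rw [h.KK, neg_neg]
  have h1 : B u (K (K v)) = 0 := by
    have h2 : B (K u) (K v) = B u (J (I (K v))) := by
      rw [← h.IJ u, kI, kJ]
    have h3 : B u (J (I (K v))) = -B u (K (K v)) := by
      simp only [hB, h.JI, map_neg]; ring
    have h4 := kK u (K v)
    linarith
  rw [hv]
  simp only [hB] at h1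
  simp only [map_sub, map_neg, map_smul, sub_apply, smul_apply, smul_eq_mul]
  linarith

/-- The pointwise data of an HKT structure with a special homothety `X` of type `(a, b)`, where
`e = a + b`: the metric and complex structures, the torsion `T`, and the commutation rules that the
homothety imposes on the endomorphisms `T (I X, ·)`, `T (J X, ·)`, `T (K X, ·)`. -/
structure HomothetyModel (g : V →L[ℝ] V →L[ℝ] ℝ) (I J K : V →L[ℝ] V) (T : V →L[ℝ] V →L[ℝ] V)
    (X : V) (e : ℝ) : Prop extends HyperHermitian g I J K where
  swap : ∀ u v, T u v = -T v u
  skew : ∀ u v w, g u (T v w) = -g v (T u w)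
  TX : ∀ v, T X v = 0
  TII : ∀ v, I (T (I X) v) = T (I X) (I v)
  TIJ : ∀ v, J (T (I X) v) = T (I X) (J v) + e • K v
  TIK : ∀ v, K (T (I X) v) = T (I X) (K v) - e • J v
  TJJ : ∀ v, J (T (J X) v) = T (J X) (J v)
  TJK : ∀ v, K (T (J X) v) = T (J X) (K v) + e • I v
  TJI : ∀ v, I (T (J X) v) = T (J X) (I v) - e • K v
  TKK : ∀ v, K (T (K X) v) = T (K X) (K v)
  TKI : ∀ v, I (T (K X) v) = T (K X) (I v) + e • J v
  TKJ : ∀ v, J (T (K X) v) = T (K X) (J v) - e • I v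

lemma HomothetyModel.rotate {T : V →L[ℝ] V →L[ℝ] V} {X : V} {e : ℝ}
    (h : HomothetyModel g I J K T X e) : HomothetyModel g J K I T X e where
  toHyperHermitian := h.toHyperHermitian.rotate
  swap := h.swap
  skew := h.skew
  TX := h.TX
  TII := h.TJJ
  TIJ := h.TJK
  TIK := h.TJI
  TJJ := h.TKK
  TJK := h.TKI
  TJI := h.TKJ
  TKK := h.TII
  TKI := h.TIJ
  TKJ := h.TIK

/-- The symmetric form `∑ (Aᵢ X)♭ ⊗ (Aᵢ X)♭` over `Aᵢ = 1, I, J, K`. -/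
def quatSquare (g : V →L[ℝ] V →L[ℝ] ℝ) (I J K : V →L[ℝ] V) (X : V) : V →L[ℝ] V →L[ℝ] ℝ :=
  (g X).smulRight (g X) + (g (I X)).smulRight (g (I X)) + (g (J X)).smulRight (g (J X))
    + (g (K X)).smulRight (g (K X))

@[simp] lemma quatSquare_apply (X u v : V) : quatSquare g I J K X u v =
    g X u * g X v + g (I X) u * g (I X) v + g (J X) u * g (J X) v + g (K X) u * g (K X) v := by
  simp [quatSquare]

/-- The endomorphism `w ↦ ∑ g(Aᵢ X, w) Aᵢ X` over `Aᵢ = 1, I, J, K`, which is `g`-dual to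
`quatSquare`. -/
def quatProj (g : V →L[ℝ] V →L[ℝ] ℝ) (I J K : V →L[ℝ] V) (X : V) : V →L[ℝ] V :=
  (g X).smulRight X + (g (I X)).smulRight (I X) + (g (J X)).smulRight (J X)
    + (g (K X)).smulRight (K X)

@[simp] lemma quatProj_apply (X w : V) : quatProj g I J K X w =
    g X w • X + g (I X) w • I X + g (J X) w • J X + g (K X) w • K X := by
  simp [quatProj]

/-- The inverse, if `p` and `p + r g(X, X)` do not vanish, of `p + r ∑ Aᵢ X ⊗ (Aᵢ X)♭`, the
endomorphism that relates the deformed metric `p g + r ∑ (Aᵢ X)♭ ⊗ (Aᵢ X)♭` to `g`. -/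
def deformInv (g : V →L[ℝ] V →L[ℝ] ℝ) (I J K : V →L[ℝ] V) (X : V) (p r : ℝ) : V →L[ℝ] V :=
  p⁻¹ • (ContinuousLinearMap.id ℝ V - (r / (p + r * g X X)) • quatProj g I J K X)

lemma deformInv_apply (X w : V) (p r : ℝ) : deformInv g I J K X p r w =
    p⁻¹ • (w - (r / (p + r * g X X)) • quatProj g I J K X w) := by
  simp [deformInv]

/-- The change of the HKT connection when `g` is deformed to the metric
`g' = p g + r ∑ (Aᵢ X)♭ ⊗ (Aᵢ X)♭` with `dp = (a - b) r X♭` and `dr = s X♭`. If `∇'` denotes the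
connection of `g'`, then `g'(∇'_v Z - ∇_v Z, w) = g(preChange z v, w)` for a field `Z` with value
`z`. -/
def preChange (g : V →L[ℝ] V →L[ℝ] ℝ) (I J K : V →L[ℝ] V) (T : V →L[ℝ] V →L[ℝ] V)
    (X : V) (a b r s : ℝ) (z : V) : V →L[ℝ] V :=
  (r * (a - b) / 2) • ((g X).smulRight z + g X z • ContinuousLinearMap.id ℝ V + g (I X) z • I
      + g (J X) z • J + g (K X) z • K)
    + (r * b / 2) • ((g z).smulRight X - (g (I z)).smulRight (I X) - (g (J z)).smulRight (J X)
      - (g (K z)).smulRight (K X))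
    + (g X).smulRight ((s / 2) • quatProj g I J K X z)
    + (g (I X)).smulRight (r • (T (I X) z + ((a + b) / 2) • I z)
      + (s / 2) • (g X z • I X - g (I X) z • X - g (J X) z • K X + g (K X) z • J X))
    + (g (J X)).smulRight (r • (T (J X) z + ((a + b) / 2) • J z)
      + (s / 2) • (g X z • J X - g (J X) z • X - g (K X) z • I X + g (I X) z • K X))
    + (g (K X)).smulRight (r • (T (K X) z + ((a + b) / 2) • K z)
      + (s / 2) • (g X z • K X - g (K X) z • X - g (I X) z • J X + g (J X) z • I X))

lemma preChange_apply (T : V →L[ℝ] V →L[ℝ] V) (X : V) (a b r s : ℝ) (z v : V) :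
    preChange g I J K T X a b r s z v =
  (r * (a - b) / 2) • (g X v • z + g X z • v + g (I X) z • I v + g (J X) z • J v + g (K X) z • K v)
    + (r * b / 2) • (g z v • X - g (I z) v • I X - g (J z) v • J X - g (K z) v • K X)
    + g X v • ((s / 2) • quatProj g I J K X z)
    + g (I X) v • (r • (T (I X) z + ((a + b) / 2) • I z)
      + (s / 2) • (g X z • I X - g (I X) z • X - g (J X) z • K X + g (K X) z • J X))
    + g (J X) v • (r • (T (J X) z + ((a + b) / 2) • J z)
      + (s / 2) • (g X z • J X - g (J X) z • X - g (K X) z • I X + g (I X) z • K X))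
    + g (K X) v • (r • (T (K X) z + ((a + b) / 2) • K z)
      + (s / 2) • (g X z • K X - g (K X) z • X - g (I X) z • J X + g (J X) z • I X)) := by
  simp [preChange]

lemma preChange_add (T : V →L[ℝ] V →L[ℝ] V) (X : V) (a b r s : ℝ) (z z' v : V) :
    preChange g I J K T X a b r s (z + z') v =
      preChange g I J K T X a b r s z v + preChange g I J K T X a b r s z' v := by
  simp only [preChange_apply, quatProj_apply, map_add, add_apply]
  module

lemma preChange_smul (T : V →L[ℝ] V →L[ℝ] V) (X : V) (a b r s : ℝ) (c : ℝ) (z v : V) :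
    preChange g I J K T X a b r s (c • z) v = c • preChange g I J K T X a b r s z v := by
  simp only [preChange_apply, quatProj_apply, map_smul, smul_apply, smul_eq_mul]
  module

section
variable {T : V →L[ℝ] V →L[ℝ] V} {X : V} {a b e p r s : ℝ}

/-- The endomorphism `deformInv` turns `g`-duals into duals for the deformed metric. -/
lemma HyperHermitian.deformInv_dual (h : HyperHermitian g I J K) (hp : p ≠ 0)
    (hu : p + r * g X X ≠ 0) (w v : V) :
    (p • g + r • quatSquare g I J K X) (deformInv g I J K X p r w) v = g w v := by
  have e1 : g (I X) X = 0 := by have := h.skewI X X; rw [h.symm X] at this; linarith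
  have e2 : g (J X) X = 0 := by have := h.skewJ X X; rw [h.symm X] at this; linarith
  have e3 : g (K X) X = 0 := by have := h.skewK X X; rw [h.symm X] at this; linarith
  simp only [deformInv_apply, quatProj_apply, quatSquare_apply, add_apply, smul_apply, map_add,
    map_smul, map_sub, sub_apply, smul_eq_mul, h.skewI, h.skewJ, h.skewK, h.II, h.JJ, h.KK, h.IJ,
    h.JI, h.JK, h.KJ, h.KI, h.IK, map_neg, neg_apply, neg_neg, e1, e2, e3]
  field_simp
  ring

lemma HyperHermitian.deformInv_comm (h : HyperHermitian g I J K) (w : V) :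
    I (deformInv g I J K X p r w) = deformInv g I J K X p r (I w) := by
  simp only [deformInv_apply, quatProj_apply, map_add, map_smul, map_sub, h.skewI, h.II, h.IJ,
    h.IK, map_neg, neg_apply]
  module

lemma HomothetyModel.preChange_comm (h : HomothetyModel g I J K T X (a + b)) (z v : V) :
    I (preChange g I J K T X a b r s z v) = preChange g I J K T X a b r s (I z) v := by
  simp only [preChange_apply, quatProj_apply, map_add, map_smul, map_sub, h.skewI, h.II, h.IJ,
    h.JI, h.IK, h.KI, map_neg, neg_apply, h.TII, h.TJI, h.TKI]
  module

lemma HomothetyModel.preChange_rotate (z v : V) :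
    preChange g J K I T X a b r s z v = preChange g I J K T X a b r s z v := by
  simp only [preChange_apply, quatProj_apply]
  module

lemma HomothetyModel.skew_right (h : HomothetyModel g I J K T X e) (u v w : V) :
    g v (T u w) = -g w (T u v) := by
  rw [h.skew v u w, h.swap v w, map_neg, neg_neg, h.skew u w v]

/-- The right-hand side is the derivative in the direction `v` of the coefficients of the deformed
metric, so that the new connection preserves this metric. -/
lemma HomothetyModel.preChange_metric (h : HomothetyModel g I J K T X (a + b)) (v y z : V) :
    g (preChange g I J K T X a b r s y v) z + g y (preChange g I J K T X a b r s z v) =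
      (a - b) * r * g X v * g y z + s * g X v * quatSquare g I J K X y z
      + r * (a / 2) * (g v y * g X z + g X y * g v z + g (I v) y * g (I X) z
        + g (I X) y * g (I v) z + g (J v) y * g (J X) z + g (J X) y * g (J v) z
        + g (K v) y * g (K X) z + g (K X) y * g (K v) z) := by
  have hT : ∀ u, g (T u y) z = -g y (T u z) := fun u ↦ by
    rw [h.symm, h.skew_right]
  have hX : g y X = g X y := h.symm _ _
  have hIX : g (I y) X = -g (I X) y := by rw [h.symm, h.skewI]
  have hJX : g (J y) X = -g (J X) y := by rw [h.symm, h.skewJ]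
  have hKX : g (K y) X = -g (K X) y := by rw [h.symm, h.skewK]
  have hv : g y v = g v y := h.symm _ _
  have hIv : g (I y) v = -g (I v) y := by rw [h.symm, h.skewI]
  have hJv : g (J y) v = -g (J v) y := by rw [h.symm, h.skewJ]
  have hKv : g (K y) v = -g (K v) y := by rw [h.symm, h.skewK]
  have hz : g z v = g v z := h.symm _ _
  have hIz : g (I z) v = -g (I v) z := by rw [h.symm, h.skewI]
  have hJz : g (J z) v = -g (J v) z := by rw [h.symm, h.skewJ]
  have hKz : g (K z) v = -g (K v) z := by rw [h.symm, h.skewK]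
  simp only [preChange_apply, quatProj_apply, quatSquare_apply, add_apply, smul_apply, map_add,
    map_smul, map_sub, sub_apply, smul_eq_mul, h.skewI, h.skewJ, h.skewK, hT, hX, hIX, hJX, hKX,
    hv, hIv, hJv, hKv, hz, hIz, hJz, hKz]
  ring

/-- The new torsion, with its index lowered by the deformed metric, is skew in the first two
arguments. -/
lemma HomothetyModel.preChange_skew (h : HomothetyModel g I J K T X (a + b)) (w y z : V) :
    (p • g + r • quatSquare g I J K X) w (T y z) + g (preChange g I J K T X a b r s z y) w
      - g (preChange g I J K T X a b r s y z) w =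
    - ((p • g + r • quatSquare g I J K X) y (T w z) + g (preChange g I J K T X a b r s z w) y
      - g (preChange g I J K T X a b r s w z) y) := by
  have h0 : ∀ u v, g X (T u v) = 0 := fun u v ↦ by rw [h.skew, h.TX]; simp
  have h1 : g y (T w z) = -g w (T y z) := h.skew _ _ _
  have h2 : ∀ A : V →L[ℝ] V, g (A X) (T y z) = -g y (T (A X) z) := fun A ↦ h.skew _ _ _
  have h3 : ∀ A : V →L[ℝ] V, g (A X) (T w z) = -g w (T (A X) z) := fun A ↦ h.skew _ _ _
  have h4 : ∀ u, g (T u z) w = g w (T u z) := fun u ↦ h.symm _ _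
  have h5 : ∀ u, g (T u z) y = g y (T u z) := fun u ↦ h.symm _ _
  have h6 : ∀ u, g (T u y) w = g w (T u y) := fun u ↦ h.symm _ _
  have h7 : ∀ u, g (T u w) y = -g w (T u y) := fun u ↦ by rw [h.symm, h.skew_right]
  have hy : g y w = g w y := h.symm _ _
  have hIy : g (I y) w = -g (I w) y := by rw [h.symm, h.skewI]
  have hJy : g (J y) w = -g (J w) y := by rw [h.symm, h.skewJ]
  have hKy : g (K y) w = -g (K w) y := by rw [h.symm, h.skewK]
  have hz : g z w = g w z := h.symm _ _
  have hIz : g (I z) w = -g (I w) z := by rw [h.symm, h.skewI]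
  have hJz : g (J z) w = -g (J w) z := by rw [h.symm, h.skewJ]
  have hKz : g (K z) w = -g (K w) z := by rw [h.symm, h.skewK]
  have hzy : g z y = g y z := h.symm _ _
  have hIzy : g (I z) y = -g (I y) z := by rw [h.symm, h.skewI]
  have hJzy : g (J z) y = -g (J y) z := by rw [h.symm, h.skewJ]
  have hKzy : g (K z) y = -g (K y) z := by rw [h.symm, h.skewK]
  simp only [preChange_apply, quatProj_apply, quatSquare_apply, add_apply, smul_apply, map_add,
    map_smul, map_sub, sub_apply, smul_eq_mul, h0, h1, h2, h3, h4, h5, h6, h7, hy, hIy, hJy, hKy,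
    hz, hIz, hJz, hKz, hzy, hIzy, hJzy, hKzy]
  ring

end

end Pointwise

/-! ### Consequences of the homothety -/

section

variable {E : Type*} [NormedAddCommGroup E] [NormedSpace ℝ E]
  {M : Type*} [TopologicalSpace M] [ChartedSpace E M] [IsManifold 𝓘(ℝ, E) ∞ M]
  {g : BilinField E M} {I J K : EndField E M} {X : VField E M} {a b : ℝ} {U : Set M}
  {nabla : ConnectionOp E M} {x : M}

lemma VField.SmoothOn.smAt {Y : VField E M} (hY : Y.SmoothOn U) (hU : IsOpen U) (hx : x ∈ U) :
    SmAt Y x := (hY x hx).contMDiffAt (hU.mem_nhds hx)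

lemma IsHermitianOn.skew {A : EndField E M} (h : IsHermitianOn g A U)
    (hA : ∀ x ∈ U, ∀ v, A x (A x v) = -v) (hx : x ∈ U) (u v : TangentSpace 𝓘(ℝ, E) x) :
    g x u (A x v) = -g x (A x u) v := by
  rw [← h x hx u (A x v), hA x hx, map_neg]

lemma IsHKTOn.hyperHermitian (h : IsHKTOn g I J K U) (hx : x ∈ U) :
    HyperHermitian (g x) (I x) (J x) (K x) := by
  have II := h.hypercomplex.complexI.sq x hx
  have JJ := h.hypercomplex.complexJ.sq x hx
  have IJ := h.hypercomplex.mul_IJ x hx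
  have JI := h.hypercomplex.mul_JI x hx
  have KJ : ∀ v, K x (J x v) = -I x v := fun v ↦ by rw [← IJ, JJ, map_neg]
  exact
  { symm := h.metric.symm x hx
    nondeg := h.metric.nondegenerate x hx
    II := II
    JJ := JJ
    KK := h.hypercomplex.complexK.sq x hx
    IJ := IJ
    JI := JI
    JK := fun v ↦ by rw [← IJ, JI, KJ, neg_neg]
    KJ := KJ
    KI := fun v ↦ by rw [← IJ, JI, map_neg, ← IJ, II, neg_neg]
    IK := fun v ↦ by rw [← IJ, II]
    skewI := h.hermitianI.skew h.hypercomplex.complexI.sq hx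
    skewJ := h.hermitianJ.skew h.hypercomplex.complexJ.sq hx
    skewK := h.hermitianK.skew h.hypercomplex.complexK.sq hx }

lemma IsHKTConnectionOn.rotate (h : IsHKTConnectionOn nabla g I J K U) :
    IsHKTConnectionOn nabla g J K I U :=
  ⟨h.connection, h.smooth, h.metric, h.parallelJ, h.parallelK, h.parallelI, h.skew_left,
    h.skew_right⟩

lemma IsHypercomplexOn.rotate (h : IsHypercomplexOn I J K U) : IsHypercomplexOn J K I U := by
  have KJ : ∀ x ∈ U, ∀ v, K x (J x v) = -I x v := fun x hx v ↦ by
    rw [← h.mul_IJ x hx, h.complexJ.sq x hx, map_neg]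
  exact ⟨h.complexJ, h.complexK, h.complexI,
    fun x hx v ↦ by rw [← h.mul_IJ x hx, h.mul_JI x hx, KJ x hx, neg_neg], KJ⟩

lemma IsHKTOn.rotate (h : IsHKTOn g I J K U) : IsHKTOn g J K I U :=
  ⟨h.hypercomplex.rotate, h.metric, h.hermitianJ, h.hermitianK, h.hermitianI,
    h.exists_connection.imp fun _ hn ↦ hn.rotate⟩

lemma IsSpecialHomothetyOn.rotate (h : IsSpecialHomothetyOn X g I J K a b U) :
    IsSpecialHomothetyOn X g J K I a b U :=
  ⟨h.smooth, h.lie_X_g, h.lie_JX_g, h.lie_KX_g, h.lie_IX_g, h.lie_JX_J, h.lie_KX_K, h.lie_IX_I,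
    h.lie_JX_K, h.lie_KX_I, h.lie_IX_J⟩

/-- A globally defined HKT structure with a chosen HKT connection and a special homothety of type
`(a, b)`. -/
structure HomothetySetting (nabla : ConnectionOp E M) (g : BilinField E M) (I J K : EndField E M)
    (X : VField E M) (a b : ℝ) : Prop where
  hkt : IsHKTOn g I J K Set.univ
  conn : IsHKTConnectionOn nabla g I J K Set.univ
  hom : IsSpecialHomothetyOn X g I J K a b Set.univ
  ha : a ≠ 0
  hab : a ≠ b

namespace HomothetySetting

lemma rotate (h : HomothetySetting nabla g I J K X a b) : HomothetySetting nabla g J K I X a b :=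
  ⟨h.hkt.rotate, h.conn.rotate, h.hom.rotate, h.ha, h.hab⟩

variable (h : HomothetySetting nabla g I J K X a b)
include h

lemma hyperHermitian (x : M) : HyperHermitian (g x) (I x) (J x) (K x) :=
  h.hkt.hyperHermitian trivial

lemma smAt_X (x : M) : SmAt X x := h.hom.smooth.smAt isOpen_univ trivial

lemma smAt_I {Y : VField E M} (hY : SmAt Y x) : SmAt (I.app Y) x :=
  h.hkt.hypercomplex.complexI.smooth.smAt_app isOpen_univ trivial hY

lemma diffAt_I {Y : VField E M} (hY : DiffAt Y x) : DiffAt (I.app Y) x :=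
  h.hkt.hypercomplex.complexI.smooth.diffAt_app isOpen_univ trivial hY

lemma fsmAt_g {Y Z : VField E M} (hY : SmAt Y x) (hZ : SmAt Z x) : FSmAt E (g.app Y Z) x :=
  h.hkt.metric.smooth.fsmAt_app isOpen_univ trivial hY hZ

lemma mdiffAt_g {Y Z : VField E M} (hY : DiffAt Y x) (hZ : DiffAt Z x) :
    MDifferentiableAt 𝓘(ℝ, E) 𝓘(ℝ, ℝ) (g.app Y Z) x :=
  h.hkt.metric.smooth.mdifferentiableAt_app isOpen_univ trivial hY hZ

variable [FiniteDimensional ℝ E] [CompleteSpace E]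

/-- The torsion tensor of the HKT connection. -/
def tor (x : M) :
    TangentSpace 𝓘(ℝ, E) x →L[ℝ] TangentSpace 𝓘(ℝ, E) x →L[ℝ] TangentSpace 𝓘(ℝ, E) x :=
  h.conn.connection.torsion x

lemma tor_apply {Y Z : VField E M} (hY : DiffAt Y x) (hZ : DiffAt Z x) :
    h.tor x (Y x) (Z x) = torsion nabla Y Z x :=
  h.conn.connection.torsion_apply hY hZ

lemma tor_rotate (x : M) : h.rotate.tor x = h.tor x := rfl

lemma bracket_eq {Y Z : VField E M} (hY : DiffAt Y x) (hZ : DiffAt Z x) :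
    bracket Y Z x = nabla Z x (Y x) - nabla Y x (Z x) - h.tor x (Y x) (Z x) := by
  rw [h.tor_apply hY hZ, torsion]; abel

lemma tor_swap (u v : TangentSpace 𝓘(ℝ, E) x) : h.tor x u v = -h.tor x v u :=
  h.conn.connection.torsion_antisymm u v

lemma tor_skew (u v w : TangentSpace 𝓘(ℝ, E) x) :
    g x u (h.tor x v w) = -g x v (h.tor x u w) := by
  have := h.conn.skew_left x trivial (extend u) (extend v) (extend w) (diffAt_extend u)
    (diffAt_extend v) (diffAt_extend w)
  simp only [torsionForm, BilinField.app, ← h.tor_apply (diffAt_extend v) (diffAt_extend w),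
    ← h.tor_apply (diffAt_extend u) (diffAt_extend w), extend_self] at this
  exact this

/-- Total skewness of the torsion removes it from the Lie derivative of the metric. -/
lemma lieBilin_eq {V Y Z : VField E M} (hV : DiffAt V x) (hY : DiffAt Y x) (hZ : DiffAt Z x) :
    lieBilin V g Y Z x = g x (nabla V x (Y x)) (Z x) + g x (Y x) (nabla V x (Z x)) := by
  have hs := (h.hyperHermitian x).symm
  have h1 : g x (h.tor x (V x) (Y x)) (Z x) = -g x (Y x) (h.tor x (V x) (Z x)) := by
    rw [hs, h.tor_swap, map_neg, h.tor_skew, h.tor_swap (Z x), map_neg, neg_neg]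
  rw [lieBilin, h.conn.metric x trivial Y Z hY hZ, h.bracket_eq hV hY, h.bracket_eq hV hZ]
  simp only [map_sub, sub_apply, h1]
  ring

lemma lieEnd_eq {A : EndField E M} (hA : ∀ Y : VField E M, DiffAt Y x → DiffAt (A.app Y) x)
    (hp : ∀ Y : VField E M, DiffAt Y x → ∀ v, nabla (A.app Y) x v = A x (nabla Y x v))
    {V Y : VField E M} (hV : DiffAt V x) (hY : DiffAt Y x) :
    lieEnd V A Y x = A x (nabla V x (Y x)) - nabla V x (A x (Y x)) + A x (h.tor x (V x) (Y x))
      - h.tor x (V x) (A x (Y x)) := by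
  rw [lieEnd, h.bracket_eq hV (hA Y hY), h.bracket_eq hV hY, hp Y hY]
  simp only [EndField.app, map_sub]
  abel

/-- The special homothety satisfies `∇X = a/2`. -/
lemma nabla_X (v : TangentSpace 𝓘(ℝ, E) x) : nabla X x v = (a / 2) • v := by
  have hX := (h.smAt_X x).diffAt
  refine (h.hyperHermitian x).eq_half_smul ?_ ?_ ?_ ?_ v
  · intro u v
    have := h.hom.lie_X_g x trivial (extend u) (extend v) (diffAt_extend u) (diffAt_extend v)
    rwa [h.lieBilin_eq hX (diffAt_extend u) (diffAt_extend v), extend_self, extend_self] at this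
  · intro u v
    have := h.hom.lie_IX_g x trivial (extend u) (extend v) (diffAt_extend u) (diffAt_extend v)
    rwa [h.lieBilin_eq (h.diffAt_I hX) (diffAt_extend u) (diffAt_extend v), extend_self,
      extend_self, h.conn.parallelI x trivial X hX, h.conn.parallelI x trivial X hX,
      zero_mul] at this
  · intro u v
    have := h.hom.lie_JX_g x trivial (extend u) (extend v) (diffAt_extend u) (diffAt_extend v)
    rwa [h.lieBilin_eq (h.rotate.diffAt_I hX) (diffAt_extend u) (diffAt_extend v),
      extend_self, extend_self, h.conn.parallelJ x trivial X hX,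
      h.conn.parallelJ x trivial X hX, zero_mul] at this
  · intro u v
    have := h.hom.lie_KX_g x trivial (extend u) (extend v) (diffAt_extend u) (diffAt_extend v)
    rwa [h.lieBilin_eq (h.rotate.rotate.diffAt_I hX) (diffAt_extend u) (diffAt_extend v),
      extend_self, extend_self, h.conn.parallelK x trivial X hX, h.conn.parallelK x trivial X hX,
      zero_mul] at this

lemma nabla_IX (v : TangentSpace 𝓘(ℝ, E) x) : nabla (I.app X) x v = (a / 2) • I x v := by
  rw [h.conn.parallelI x trivial X (h.smAt_X x).diffAt, h.nabla_X, map_smul]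

/-- `dμ = 2 / (a - b) X♭`. -/
lemma d_potentialOf (v : TangentSpace 𝓘(ℝ, E) x) :
    d (potentialOf X g a b) x v = 2 / (a - b) * g x (X x) v := by
  have hX := (h.smAt_X x).diffAt
  have h1 : d (potentialOf X g a b) x v = 2 / (a * (a - b)) * d (g.app X X) x v :=
    d_const_mul _ (h.mdiffAt_g hX hX) v
  rw [h1, h.conn.metric x trivial X X hX hX, h.nabla_X, map_smul, map_smul, smul_apply,
    (h.hyperHermitian x).symm v]
  have := h.ha
  have := sub_ne_zero.2 h.hab
  simp only [smul_eq_mul]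
  field_simp
  ring

lemma fsmAt_potentialOf (x : M) : FSmAt E (potentialOf X g a b) x :=
  contMDiffAt_const.mul (h.fsmAt_g (h.smAt_X x) (h.smAt_X x))

lemma d_gX {Y : VField E M} (hY : DiffAt Y x) (v : TangentSpace 𝓘(ℝ, E) x) :
    d (g.app X Y) x v = a / 2 * g x v (Y x) + g x (X x) (nabla Y x v) := by
  rw [h.conn.metric x trivial X Y (h.smAt_X x).diffAt hY, h.nabla_X, map_smul, smul_apply,
    smul_eq_mul]

lemma d_gIX {Y : VField E M} (hY : DiffAt Y x) (v : TangentSpace 𝓘(ℝ, E) x) :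
    d (g.app (I.app X) Y) x v = a / 2 * g x (I x v) (Y x) + g x (I x (X x)) (nabla Y x v) := by
  rw [h.conn.metric x trivial _ Y (h.diffAt_I (h.smAt_X x).diffAt) hY, h.nabla_IX, map_smul,
    smul_apply, smul_eq_mul]
  rfl

/-- Since `X♭` is a multiple of `dμ`, hence closed, the torsion vanishes on `X`. -/
lemma tor_X (v : TangentSpace 𝓘(ℝ, E) x) : h.tor x (X x) v = 0 := by
  refine (h.hyperHermitian x).nondeg _ fun w ↦ ?_
  have hb := sub_ne_zero.2 h.hab
  have hd : d (potentialOf X g a b) = fun y ↦ (2 / (a - b)) • g y (X y) := by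
    funext y
    ext u
    rw [h.d_potentialOf]; rfl
  have h1 := extD_d (h.fsmAt_potentialOf x) (diffAt_extend v) (diffAt_extend w)
  have h2 : ∀ {Y : VField E M}, DiffAt Y x → ∀ u,
      d (E := E) (fun y ↦ d (potentialOf X g a b) y (Y y)) x u =
        2 / (a - b) * d (g.app X Y) x u := by
    intro Y hY u
    rw [hd]
    exact d_const_mul _ (h.mdiffAt_g (h.smAt_X x).diffAt hY) u
  rw [extD, h2 (diffAt_extend w), h2 (diffAt_extend v), h.d_potentialOf, h.d_gX (diffAt_extend w),
    h.d_gX (diffAt_extend v), h.bracket_eq (diffAt_extend v) (diffAt_extend w)] at h1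
  simp only [extend_self, map_sub, (h.hyperHermitian x).symm w v] at h1
  have h3 : 2 / (a - b) * g x (X x) (h.tor x v w) = 0 := by linarith
  have h4 : g x (X x) (h.tor x v w) = 0 := by
    rcases mul_eq_zero.1 h3 with h5 | h5
    · exact absurd h5 (div_ne_zero two_ne_zero hb)
    · exact h5
  rw [(h.hyperHermitian x).symm, h.tor_skew, h.tor_swap, map_neg, neg_neg, h4]

lemma tor_IX_I (v : TangentSpace 𝓘(ℝ, E) x) :
    I x (h.tor x (I x (X x)) v) = h.tor x (I x (X x)) (I x v) := by
  have hX := (h.smAt_X x).diffAt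
  have := h.hom.lie_IX_I x trivial (extend v) (diffAt_extend v)
  rw [h.lieEnd_eq (fun Y ↦ h.diffAt_I) (fun Y hY ↦ h.conn.parallelI x trivial Y hY)
    (h.diffAt_I hX) (diffAt_extend v), h.nabla_IX, h.nabla_IX] at this
  simp only [extend_self, map_smul, zero_smul, EndField.app, sub_self, zero_add] at this
  exact sub_eq_zero.1 this

lemma tor_IX_J (v : TangentSpace 𝓘(ℝ, E) x) :
    J x (h.tor x (I x (X x)) v) = h.tor x (I x (X x)) (J x v) + (a + b) • K x v := by
  have hX := (h.smAt_X x).diffAt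
  have hh := h.hyperHermitian x
  have := h.hom.lie_IX_J x trivial (extend v) (diffAt_extend v)
  rw [h.lieEnd_eq (fun Y ↦ h.rotate.diffAt_I) (fun Y hY ↦ h.conn.parallelJ x trivial Y hY)
    (h.diffAt_I hX) (diffAt_extend v), h.nabla_IX, h.nabla_IX] at this
  simp only [extend_self, map_smul, EndField.app, hh.IJ, hh.JI] at this
  rw [← sub_eq_zero] at this ⊢
  rw [← this]
  module

lemma tor_IX_K (v : TangentSpace 𝓘(ℝ, E) x) :
    K x (h.tor x (I x (X x)) v) = h.tor x (I x (X x)) (K x v) - (a + b) • J x v := by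
  have hh := h.hyperHermitian x
  rw [← hh.IJ, h.tor_IX_J, map_add, h.tor_IX_I, map_smul, hh.IK, hh.IJ]
  module

/-- The pointwise model of the setting. -/
lemma model (x : M) : HomothetyModel (g x) (I x) (J x) (K x) (h.tor x) (X x) (a + b) where
  toHyperHermitian := h.hyperHermitian x
  swap := h.tor_swap
  skew := h.tor_skew
  TX := h.tor_X
  TII := h.tor_IX_I
  TIJ := h.tor_IX_J
  TIK := h.tor_IX_K
  TJJ := h.rotate.tor_IX_I
  TJK := h.rotate.tor_IX_J
  TJI := h.rotate.tor_IX_K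
  TKK := h.rotate.rotate.tor_IX_I
  TKI := h.rotate.rotate.tor_IX_J
  TKJ := h.rotate.rotate.tor_IX_K

end HomothetySetting

end

/-! ### Deformed metrics -/

section

variable {E : Type*} [NormedAddCommGroup E] [NormedSpace ℝ E]
  {M : Type*} [TopologicalSpace M] [ChartedSpace E M] [IsManifold 𝓘(ℝ, E) ∞ M]
  {g : BilinField E M} {I J K : EndField E M} {X : VField E M} {a b : ℝ} {U : Set M}
  {nabla : ConnectionOp E M} {x : M} {p r s : M → ℝ}

/-- The deformed metric `p g + r ∑ (Aᵢ X)♭ ⊗ (Aᵢ X)♭`, the sum being over `Aᵢ = 1, I, J, K`. -/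
def deformed (g : BilinField E M) (I J K : EndField E M) (X : VField E M) (p r : M → ℝ) :
    BilinField E M :=
  fun x ↦ p x • g x + r x • quatSquare (g x) (I x) (J x) (K x) (X x)

lemma deformed_apply (u v : TangentSpace 𝓘(ℝ, E) x) : deformed g I J K X p r x u v =
    p x * g x u v + r x * (g x (X x) u * g x (X x) v + g x (I x (X x)) u * g x (I x (X x)) v
      + g x (J x (X x)) u * g x (J x (X x)) v + g x (K x (X x)) u * g x (K x (X x)) v) := by
  simp [deformed]

lemma deformed_rotate : deformed g J K I X p r = deformed g I J K X p r := by
  funext x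
  ext u v
  simp only [deformed_apply]
  ring

/-- The functions `p`, `r`, `s` are smooth on the open set `U`, and they depend only on the
potential: `dp = (a - b) r X♭` and `dr = s X♭`. -/
structure IsDeformationOn (g : BilinField E M) (X : VField E M) (a b : ℝ) (p r s : M → ℝ)
    (U : Set M) : Prop where
  isOpen : IsOpen U
  smooth_p : ∀ x ∈ U, FSmAt E p x
  smooth_r : ∀ x ∈ U, FSmAt E r x
  smooth_s : ∀ x ∈ U, FSmAt E s x
  d_p : ∀ x ∈ U, ∀ v, d p x v = (a - b) * r x * g x (X x) v
  d_r : ∀ x ∈ U, ∀ v, d r x v = s x * g x (X x) v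

namespace HomothetySetting

variable (h : HomothetySetting nabla g I J K X a b) (hd : IsDeformationOn g X a b p r s U)
include h hd

lemma fsmAt_deformed (hx : x ∈ U) {Y Z : VField E M} (hY : SmAt Y x) (hZ : SmAt Z x) :
    FSmAt E ((deformed g I J K X p r).app Y Z) x := by
  have hX := h.smAt_X x
  have h1 : ∀ {W : VField E M}, SmAt W x → FSmAt E (fun y ↦ g.app W Y y * g.app W Z y) x :=
    fun hW ↦ ContMDiffAt.mul (h.fsmAt_g hW hY) (h.fsmAt_g hW hZ)
  have := ((hd.smooth_p x hx).mul (h.fsmAt_g hY hZ)).add ((hd.smooth_r x hx).mul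
    ((((h1 hX).add (h1 (h.smAt_I hX))).add (h1 (h.rotate.smAt_I hX))).add
      (h1 (h.rotate.rotate.smAt_I hX))))
  refine this.congr_of_eventuallyEq (Filter.Eventually.of_forall fun y ↦ ?_)
  exact deformed_apply _ _

/-- The derivative of the deformed metric with respect to the original connection. -/
lemma d_deformed [FiniteDimensional ℝ E] [CompleteSpace E] (hx : x ∈ U) {Y Z : VField E M}
    (hY : DiffAt Y x) (hZ : DiffAt Z x) (v : TangentSpace 𝓘(ℝ, E) x) :
    d ((deformed g I J K X p r).app Y Z) x v =
      (a - b) * r x * g x (X x) v * g x (Y x) (Z x)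
      + s x * g x (X x) v * quatSquare (g x) (I x) (J x) (K x) (X x) (Y x) (Z x)
      + r x * (a / 2) * (g x v (Y x) * g x (X x) (Z x) + g x (X x) (Y x) * g x v (Z x)
        + g x (I x v) (Y x) * g x (I x (X x)) (Z x) + g x (I x (X x)) (Y x) * g x (I x v) (Z x)
        + g x (J x v) (Y x) * g x (J x (X x)) (Z x) + g x (J x (X x)) (Y x) * g x (J x v) (Z x)
        + g x (K x v) (Y x) * g x (K x (X x)) (Z x) + g x (K x (X x)) (Y x) * g x (K x v) (Z x))
      + deformed g I J K X p r x (nabla Y x v) (Z x)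
      + deformed g I J K X p r x (Y x) (nabla Z x v) := by
  have hX := (h.smAt_X x).diffAt
  have hp := (hd.smooth_p x hx).mdifferentiableAt (by simp)
  have hr := (hd.smooth_r x hx).mdifferentiableAt (by simp)
  have hm : ∀ {W : VField E M}, DiffAt W x →
      MDifferentiableAt 𝓘(ℝ, E) 𝓘(ℝ, ℝ) (fun y ↦ g.app W Y y * g.app W Z y) x :=
    fun hW ↦ (h.mdiffAt_g hW hY).mul (h.mdiffAt_g hW hZ)
  have h0 := hm hX
  have h1 := hm (h.diffAt_I hX)
  have h2 := hm (h.rotate.diffAt_I hX)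
  have h3 := hm (h.rotate.rotate.diffAt_I hX)
  have he : (deformed g I J K X p r).app Y Z = fun y ↦ p y * g.app Y Z y + r y *
      (g.app X Y y * g.app X Z y + g.app (I.app X) Y y * g.app (I.app X) Z y
        + g.app (J.app X) Y y * g.app (J.app X) Z y
        + g.app (K.app X) Y y * g.app (K.app X) Z y) := funext fun y ↦ deformed_apply _ _
  have h01 := mdiffAt_add h0 h1
  have h012 := mdiffAt_add h01 h2
  have h0123 := mdiffAt_add h012 h3
  rw [he, d_add (mdiffAt_mul hp (h.mdiffAt_g hY hZ)) (mdiffAt_mul hr h0123),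
    d_mul hp (h.mdiffAt_g hY hZ), d_mul hr h0123, d_add h012 h3, d_add h01 h2, d_add h0 h1,
    d_mul (h.mdiffAt_g hX hY) (h.mdiffAt_g hX hZ),
    d_mul (h.mdiffAt_g (h.diffAt_I hX) hY) (h.mdiffAt_g (h.diffAt_I hX) hZ),
    d_mul (h.mdiffAt_g (h.rotate.diffAt_I hX) hY) (h.mdiffAt_g (h.rotate.diffAt_I hX) hZ),
    d_mul (h.mdiffAt_g (h.rotate.rotate.diffAt_I hX) hY)
      (h.mdiffAt_g (h.rotate.rotate.diffAt_I hX) hZ),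
    h.d_gX hY, h.d_gX hZ, h.d_gIX hY, h.d_gIX hZ, h.rotate.d_gIX hY, h.rotate.d_gIX hZ,
    h.rotate.rotate.d_gIX hY, h.rotate.rotate.d_gIX hZ, h.conn.metric x trivial Y Z hY hZ,
    hd.d_p x hx, hd.d_r x hx]
  simp only [deformed_apply, quatSquare_apply, BilinField.app, EndField.app]
  ring

variable [FiniteDimensional ℝ E] [CompleteSpace E]

lemma extD_dTwist₀ {φ : M → ℝ}
    (hφ : ∀ x ∈ U, ∀ v, d φ x v = 2 / (a - b) * p x * g x (X x) v) (hx : x ∈ U)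
    {Y Z : VField E M} (hY : DiffAt Y x) (hZ : DiffAt Z x) :
    extD (dTwist₀ I φ) Y Z x =
      2 * r x * (g x (X x) (Y x) * g x (I x (X x)) (Z x) - g x (I x (X x)) (Y x) * g x (X x) (Z x))
      + 2 / (a - b) * p x * (a * g x (I x (Y x)) (Z x)
        - g x (Y x) (h.tor x (I x (X x)) (Z x))) := by
  have hX := (h.smAt_X x).diffAt
  have hb := sub_ne_zero.2 h.hab
  have hh := h.hyperHermitian x
  have hp := (hd.smooth_p x hx).mdifferentiableAt (by simp)
  have hval : ∀ y ∈ U, ∀ v, dTwist₀ I φ y v = 2 / (a - b) * (p y * g y (I y (X y)) v) := by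
    intro y hy v
    have : dTwist₀ I φ y v = -d φ y (I y v) := by simp [dTwist₀, twist]
    rw [this, hφ y hy, (h.hyperHermitian y).skewI]
    ring
  have hD : ∀ {W : VField E M}, DiffAt W x → ∀ v,
      d (fun y ↦ dTwist₀ I φ y (W y)) x v = 2 / (a - b) *
        ((a - b) * r x * g x (X x) v * g x (I x (X x)) (W x)
          + p x * (a / 2 * g x (I x v) (W x) + g x (I x (X x)) (nabla W x v))) := by
    intro W hW v
    have h1 : (fun y ↦ dTwist₀ I φ y (W y)) =ᶠ[𝓝 x]
        fun y ↦ 2 / (a - b) * (p y * g.app (I.app X) W y) := by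
      filter_upwards [hd.isOpen.mem_nhds hx] with y hy
      exact hval y hy (W y)
    have h2 := h.mdiffAt_g (h.diffAt_I hX) hW
    rw [d_congr h1, d_const_mul _ (mdiffAt_mul hp h2), d_mul hp h2, h.d_gIX hW, hd.d_p x hx]
    rfl
  have hT : g x (I x (X x)) (h.tor x (Y x) (Z x)) = -g x (Y x) (h.tor x (I x (X x)) (Z x)) :=
    h.tor_skew _ _ _
  have hI : g x (I x (Z x)) (Y x) = -g x (I x (Y x)) (Z x) := by rw [hh.symm, hh.skewI]
  rw [extD, hD hZ, hD hY, hval x hx, h.bracket_eq hY hZ]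
  simp only [map_sub, hT, hI]
  field_simp
  ring

/-- A function `φ` with `dφ = (2 / (a - b)) p X♭` is a potential of the deformed metric. -/
lemma potentialEqOn_deformed {φ : M → ℝ}
    (hφ : ∀ x ∈ U, ∀ v, d φ x v = 2 / (a - b) * p x * g x (X x) v) :
    PotentialEqOn φ (deformed g I J K X p r) I J K U := by
  intro x hx Y Z hY hZ
  have hm := h.model x
  have hb := sub_ne_zero.2 h.hab
  -- The second term is minus the first one evaluated on `J Y`, `J Z`.
  have htw : twist J (dTwist₀ K φ) = dTwist₀ I φ := by
    funext y
    ext v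
    simp [dTwist₀, twist, (h.hyperHermitian y).KJ]
  have hT : h.tor x (I x (X x)) (J x (Z x)) =
      J x (h.tor x (I x (X x)) (Z x)) - (a + b) • K x (Z x) := by rw [hm.TIJ]; abel
  rw [dTwist₁, htw, h.extD_dTwist₀ hd hφ hx hY hZ,
    h.extD_dTwist₀ hd hφ hx (h.rotate.diffAt_I hY) (h.rotate.diffAt_I hZ)]
  simp only [EndField.app, deformed_apply, hT, map_sub, map_smul, hm.skewI, hm.skewJ, hm.skewK,
    hm.II, hm.JJ, hm.IJ, hm.JI, hm.KJ, hm.JK, hm.IK, map_neg, neg_apply, smul_eq_mul]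
  field_simp
  ring

lemma lieBilin_deformed (hx : x ∈ U) {V Y Z : VField E M} (hV : DiffAt V x) (hY : DiffAt Y x)
    (hZ : DiffAt Z x) :
    lieBilin V (deformed g I J K X p r) Y Z x =
      (a - b) * r x * g x (X x) (V x) * g x (Y x) (Z x)
      + s x * g x (X x) (V x) * quatSquare (g x) (I x) (J x) (K x) (X x) (Y x) (Z x)
      + r x * (a / 2) * (g x (V x) (Y x) * g x (X x) (Z x) + g x (X x) (Y x) * g x (V x) (Z x)
        + g x (I x (V x)) (Y x) * g x (I x (X x)) (Z x)
        + g x (I x (X x)) (Y x) * g x (I x (V x)) (Z x)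
        + g x (J x (V x)) (Y x) * g x (J x (X x)) (Z x)
        + g x (J x (X x)) (Y x) * g x (J x (V x)) (Z x)
        + g x (K x (V x)) (Y x) * g x (K x (X x)) (Z x)
        + g x (K x (X x)) (Y x) * g x (K x (V x)) (Z x))
      + deformed g I J K X p r x (nabla V x (Y x) + h.tor x (V x) (Y x)) (Z x)
      + deformed g I J K X p r x (Y x) (nabla V x (Z x) + h.tor x (V x) (Z x)) := by
  rw [lieBilin, h.d_deformed hd hx hY hZ, h.bracket_eq hV hY, h.bracket_eq hV hZ]
  simp only [map_sub, map_add, sub_apply, add_apply]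
  ring

lemma lieBilin_X_deformed (hx : x ∈ U) {Y Z : VField E M} (hY : DiffAt Y x) (hZ : DiffAt Z x) :
    lieBilin X (deformed g I J K X p r) Y Z x =
      ((a - b) * r x * g x (X x) (X x) + a * p x) * g x (Y x) (Z x)
      + (s x * g x (X x) (X x) + 2 * a * r x)
        * quatSquare (g x) (I x) (J x) (K x) (X x) (Y x) (Z x) := by
  rw [h.lieBilin_deformed hd hx (h.smAt_X x).diffAt hY hZ, h.nabla_X, h.nabla_X, h.tor_X, h.tor_X]
  simp only [add_zero, map_smul, smul_apply, deformed_apply, quatSquare_apply, smul_eq_mul]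
  ring

lemma lieBilin_IX_deformed : LieBilinEqOn (I.app X) (deformed g I J K X p r) 0 U := by
  intro x hx Y Z hY hZ
  have hm := h.model x
  have h1 : g x (I x (X x)) (X x) = 0 := by
    have := hm.skewI (X x) (X x); rw [hm.symm (X x)] at this; linarith
  have hIX : ∀ v, g x (X x) (h.tor x (I x (X x)) v) = 0 := fun v ↦ by
    rw [hm.skew, hm.TX, map_zero, neg_zero]
  have hII : ∀ v, g x (I x (X x)) (h.tor x (I x (X x)) v) = 0 := fun v ↦ by
    have := hm.skew (I x (X x)) (I x (X x)) v; linarith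
  have hTX : h.tor x (I x (X x)) (X x) = 0 := by rw [hm.swap, hm.TX, neg_zero]
  have hIJ : ∀ v, g x (J x (X x)) (h.tor x (I x (X x)) v) = (a + b) * g x (K x (X x)) v := by
    intro v
    have := hm.TIJ (X x)
    rw [hTX, map_zero] at this
    rw [hm.skew_right, eq_neg_of_add_eq_zero_left this.symm, map_neg, map_smul, hm.skewK, hm.symm]
    simp [hm.skewK]
  have hIK : ∀ v, g x (K x (X x)) (h.tor x (I x (X x)) v) = -(a + b) * g x (J x (X x)) v := by
    intro v
    have := hm.TIK (X x)
    rw [hTX, map_zero] at this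
    rw [hm.skew_right, sub_eq_zero.1 this.symm, map_smul, hm.symm]
    simp only [smul_eq_mul]
    ring
  have hT : g x (h.tor x (I x (X x)) (Y x)) (Z x) = -g x (Y x) (h.tor x (I x (X x)) (Z x)) := by
    rw [hm.symm, hm.skew_right]
  rw [h.lieBilin_deformed hd hx (h.diffAt_I (h.smAt_X x).diffAt) hY hZ, h.nabla_IX, h.nabla_IX]
  simp only [EndField.app, deformed_apply, quatSquare_apply, map_add, map_smul, add_apply,
    smul_apply, hIX, hII, hIJ, hIK, hT, hm.skewI, hm.II, hm.IJ, hm.JI, hm.IK, hm.KI, map_neg,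
    neg_apply, h1, smul_eq_mul]
  ring

end HomothetySetting

end

/-! ### The HKT connection of a deformed metric -/

section

variable {E : Type*} [NormedAddCommGroup E] [NormedSpace ℝ E]
  {M : Type*} [TopologicalSpace M] [ChartedSpace E M] [IsManifold 𝓘(ℝ, E) ∞ M]
  {g : BilinField E M} {I J K : EndField E M} {X : VField E M} {a b : ℝ} {U : Set M}
  {nabla : ConnectionOp E M} {x : M} {p r s : M → ℝ}

lemma IsComplexStructureOn.mono {A : EndField E M} {V : Set M} (h : IsComplexStructureOn A V)
    (hU : U ⊆ V) : IsComplexStructureOn A U :=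
  ⟨ContMDiffOn.mono h.smooth hU, fun x hx ↦ h.sq x (hU hx), fun x hx ↦ h.integrable x (hU hx)⟩

lemma IsHypercomplexOn.mono {V : Set M} (h : IsHypercomplexOn I J K V) (hU : U ⊆ V) :
    IsHypercomplexOn I J K U :=
  ⟨h.complexI.mono hU, h.complexJ.mono hU, h.complexK.mono hU, fun x hx ↦ h.mul_IJ x (hU hx),
    fun x hx ↦ h.mul_JI x (hU hx)⟩

/-- A smooth connection differentiates fields that are smooth on an open set to smooth fields. -/
lemma smAt_nabla [FiniteDimensional ℝ E] [T2Space M] (hc : IsCovariantDerivativeOn E nabla)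
    (hs : ContMDiffCovariantDerivativeOn E ∞ nabla Set.univ) (hU : IsOpen U) {W Z : VField E M}
    (hZ : Z.SmoothOn U) (hx : x ∈ U) (hW : SmAt W x) : SmAt (fun y ↦ nabla Z y (W y)) x := by
  obtain ⟨Z', hZ', he⟩ := exists_global hU hZ hx
  have h1 := ((hs.contMDiff hZ') x trivial).contMDiffAt Filter.univ_mem
  have h2 : SmAt (fun y ↦ nabla Z' y (W y)) x := ContMDiffAt.clm_bundle_apply h1 hW
  refine ContMDiffAt.congr_of_eventuallyEq h2 ?_
  filter_upwards [eventually_eventually_nhds.2 he, hU.mem_nhds hx] with y hy hyU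
  have : nabla Z' y = nabla Z y :=
    hc.congr_of_eventuallyEq (hZ'.smAt isOpen_univ trivial).diffAt (hZ.smAt hU hyU).diffAt
      Filter.univ_mem hy
  rw [this]

section
variable {V : Type*} [AddCommGroup V] [Module ℝ V] [TopologicalSpace V] [IsTopologicalAddGroup V]
  [ContinuousSMul ℝ V]

lemma deformInv_rotate (g : V →L[ℝ] V →L[ℝ] ℝ) (I J K : V →L[ℝ] V) (X : V) (p r : ℝ) :
    deformInv g J K I X p r = deformInv g I J K X p r := by
  ext w
  simp only [deformInv_apply, quatProj_apply]
  module

end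

namespace HomothetySetting

variable [FiniteDimensional ℝ E] [CompleteSpace E]
  (h : HomothetySetting nabla g I J K X a b)

/-- The HKT connection of the deformed metric. -/
def deformedConnection (p r s : M → ℝ) : ConnectionOp E M := fun Z x ↦
  nabla Z x + (deformInv (g x) (I x) (J x) (K x) (X x) (p x) (r x)).comp
    (preChange (g x) (I x) (J x) (K x) (h.tor x) (X x) a b (r x) (s x) (Z x))

lemma deformedConnection_apply (Z : VField E M) (v : TangentSpace 𝓘(ℝ, E) x) :
    h.deformedConnection p r s Z x v = nabla Z x v +
      deformInv (g x) (I x) (J x) (K x) (X x) (p x) (r x)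
        (preChange (g x) (I x) (J x) (K x) (h.tor x) (X x) a b (r x) (s x) (Z x) v) := rfl

lemma deformedConnection_rotate :
    h.rotate.deformedConnection p r s = h.deformedConnection p r s := by
  funext Z x
  ext v
  rw [deformedConnection_apply, deformedConnection_apply, deformInv_rotate, tor_rotate,
    HomothetyModel.preChange_rotate]

lemma isCovariantDerivativeOn_deformedConnection :
    IsCovariantDerivativeOn E (h.deformedConnection p r s) U where
  add {Y Z x} hY hZ hx := by
    ext v
    rw [add_apply, deformedConnection_apply, deformedConnection_apply, deformedConnection_apply,
      h.conn.connection.add hY hZ trivial, add_apply, Pi.add_apply, preChange_add, map_add]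
    abel
  leibniz {Y φ x} hY hφ hx := by
    ext v
    rw [add_apply, smul_apply, deformedConnection_apply, deformedConnection_apply,
      h.conn.connection.leibniz hY hφ trivial, add_apply, Pi.smul_apply', preChange_smul, map_smul,
      smul_apply]
    module

lemma deformedConnection_parallelI {Y : VField E M} (hY : DiffAt Y x)
    (v : TangentSpace 𝓘(ℝ, E) x) :
    h.deformedConnection p r s (I.app Y) x v = I x (h.deformedConnection p r s Y x v) := by
  rw [deformedConnection_apply, deformedConnection_apply, h.conn.parallelI x trivial Y hY, map_add,
    (h.hyperHermitian x).deformInv_comm, (h.model x).preChange_comm]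
  rfl

/-- Along `I X` the torsion is smooth, since it can be written in terms of `∇` and the bracket. -/
lemma smAt_tor [T2Space M] (hU : IsOpen U) {Z : VField E M} (hZ : Z.SmoothOn U) (hx : x ∈ U) :
    SmAt (fun y ↦ h.tor y (I y (X y)) (Z y)) x := by
  have hIX := fun y ↦ h.smAt_I (h.smAt_X y)
  have h1 := ((smAt_nabla h.conn.connection h.conn.smooth hU hZ hx (hIX x)).sub
    (SmAt.smul (contMDiffAt_const (c := a / 2)) (h.smAt_I (hZ.smAt hU hx)))).sub
    (smAt_bracket (hIX x) (hZ.smAt hU hx))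
  refine ContMDiffAt.congr_of_eventuallyEq h1 ?_
  filter_upwards [hU.mem_nhds hx] with y hy
  have := h.bracket_eq (hIX y).diffAt (hZ.smAt hU hy).diffAt
  rw [h.nabla_IX] at this
  rw [this]
  congr 1
  simp only [EndField.app]
  abel

include h

lemma smAt_deformInv (hd : IsDeformationOn g X a b p r s U)
    (hp : ∀ x ∈ U, p x ≠ 0)
    (hu : ∀ x ∈ U, p x + r x * g x (X x) (X x) ≠ 0) {W : VField E M} (hx : x ∈ U)
    (hW : SmAt W x) :
    SmAt (fun y ↦ deformInv (g y) (I y) (J y) (K y) (X y) (p y) (r y) (W y)) x := by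
  have hX := h.smAt_X x
  have hIX := h.smAt_I hX
  have hJX := h.rotate.smAt_I hX
  have hKX := h.rotate.rotate.smAt_I hX
  have hf : FSmAt E (fun y ↦ r y / (p y + r y * g y (X y) (X y))) x :=
    (hd.smooth_r x hx).div₀
      ((hd.smooth_p x hx).add ((hd.smooth_r x hx).mul (h.fsmAt_g hX hX))) (hu x hx)
  have h1 := SmAt.smul ((hd.smooth_p x hx).inv₀ (hp x hx)) (hW.sub (SmAt.smul hf
    ((((SmAt.smul (h.fsmAt_g hX hW) hX).add (SmAt.smul (h.fsmAt_g hIX hW) hIX)).add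
      (SmAt.smul (h.fsmAt_g hJX hW) hJX)).add (SmAt.smul (h.fsmAt_g hKX hW) hKX))))
  refine ContMDiffAt.congr_of_eventuallyEq h1 (Filter.Eventually.of_forall fun y ↦ ?_)
  simp only [deformInv_apply, quatProj_apply]
  rfl

lemma smAt_preChange (hd : IsDeformationOn g X a b p r s U) [T2Space M]
    {Z W : VField E M} (hZ : Z.SmoothOn U) (hx : x ∈ U) (hW : SmAt W x) :
    SmAt (fun y ↦ preChange (g y) (I y) (J y) (K y) (h.tor y) (X y) a b (r y) (s y) (Z y) (W y))
      x := by
  have hz := hZ.smAt hd.isOpen hx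
  have hX := h.smAt_X x
  have hI : ∀ {Y : VField E M}, SmAt Y x → SmAt (fun y ↦ I y (Y y)) x := h.smAt_I
  have hJ : ∀ {Y : VField E M}, SmAt Y x → SmAt (fun y ↦ J y (Y y)) x := h.rotate.smAt_I
  have hK : ∀ {Y : VField E M}, SmAt Y x → SmAt (fun y ↦ K y (Y y)) x := h.rotate.rotate.smAt_I
  have hg : ∀ {Y Y' : VField E M}, SmAt Y x → SmAt Y' x →
    FSmAt E (fun y ↦ g y (Y y) (Y' y)) x := h.fsmAt_g
  have hr := hd.smooth_r x hx
  have hs := hd.smooth_s x hx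
  have hc : ∀ c : ℝ, FSmAt E (fun _ : M ↦ c) x := fun c ↦ contMDiffAt_const
  have hsc : ∀ {φ : M → ℝ}, FSmAt E φ x → ∀ c c' : ℝ, FSmAt E (fun y ↦ φ y * c / c') x :=
    fun hφ c c' ↦ (hφ.mul (hc c)).div_const _
  have hs2 : FSmAt E (fun y ↦ s y / 2) x := hs.div_const _
  have hqp : SmAt (fun y ↦ quatProj (g y) (I y) (J y) (K y) (X y) (Z y)) x := by
    simp only [quatProj_apply]
    exact (((SmAt.smul (hg hX hz) hX).add (SmAt.smul (hg (hI hX) hz) (hI hX))).add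
      (SmAt.smul (hg (hJ hX) hz) (hJ hX))).add (SmAt.smul (hg (hK hX) hz) (hK hX))
  simp only [preChange_apply]
  refine SmAt.add (SmAt.add (SmAt.add (SmAt.add (SmAt.add ?_ ?_) ?_) ?_) ?_) ?_
  · exact SmAt.smul (hsc hr _ _) (((((SmAt.smul (hg hX hW) hz).add (SmAt.smul (hg hX hz) hW)).add
      (SmAt.smul (hg (hI hX) hz) (hI hW))).add (SmAt.smul (hg (hJ hX) hz) (hJ hW))).add
      (SmAt.smul (hg (hK hX) hz) (hK hW)))
  · exact SmAt.smul (hsc hr _ _) ((((SmAt.smul (hg hz hW) hX).sub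
      (SmAt.smul (hg (hI hz) hW) (hI hX))).sub (SmAt.smul (hg (hJ hz) hW) (hJ hX))).sub
      (SmAt.smul (hg (hK hz) hW) (hK hX)))
  · exact SmAt.smul (hg hX hW) (SmAt.smul hs2 hqp)
  · exact SmAt.smul (hg (hI hX) hW) ((SmAt.smul hr ((h.smAt_tor hd.isOpen hZ hx).add
      (SmAt.smul (hc _) (hI hz)))).add (SmAt.smul hs2 ((((SmAt.smul (hg hX hz) (hI hX)).sub
      (SmAt.smul (hg (hI hX) hz) hX)).sub (SmAt.smul (hg (hJ hX) hz) (hK hX))).add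
      (SmAt.smul (hg (hK hX) hz) (hJ hX)))))
  · exact SmAt.smul (hg (hJ hX) hW) ((SmAt.smul hr ((h.rotate.smAt_tor hd.isOpen hZ hx).add
      (SmAt.smul (hc _) (hJ hz)))).add (SmAt.smul hs2 ((((SmAt.smul (hg hX hz) (hJ hX)).sub
      (SmAt.smul (hg (hJ hX) hz) hX)).sub (SmAt.smul (hg (hK hX) hz) (hI hX))).add
      (SmAt.smul (hg (hI hX) hz) (hK hX)))))
  · exact SmAt.smul (hg (hK hX) hW) ((SmAt.smul hr ((h.rotate.rotate.smAt_tor hd.isOpen hZ hx).add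
      (SmAt.smul (hc _) (hK hz)))).add (SmAt.smul hs2 ((((SmAt.smul (hg hX hz) (hK hX)).sub
      (SmAt.smul (hg (hK hX) hz) hX)).sub (SmAt.smul (hg (hI hX) hz) (hJ hX))).add
      (SmAt.smul (hg (hJ hX) hz) (hI hX)))))

lemma contMDiff_deformedConnection (hd : IsDeformationOn g X a b p r s U)
    (hp : ∀ x ∈ U, p x ≠ 0)
    (hu : ∀ x ∈ U, p x + r x * g x (X x) (X x) ≠ 0) [T2Space M] :
    ContMDiffCovariantDerivativeOn E ∞ (h.deformedConnection p r s) U where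
  contMDiff {Z} hZ := by
    intro x hx
    refine ContMDiffAt.contMDiffWithinAt ?_
    refine contMDiffAt_hom_of_apply (F := E) (V := (TangentSpace 𝓘(ℝ, E) : M → Type _))
      fun Y hY ↦ ?_
    have hZ' : VField.SmoothOn Z U := ContMDiffOn.of_le hZ (by simp)
    exact (smAt_nabla h.conn.connection h.conn.smooth hd.isOpen hZ' hx hY).add
      (h.smAt_deformInv hd hp hu hx (h.smAt_preChange hd hZ' hx hY))

lemma deformed_deformInv (hp : ∀ x ∈ U, p x ≠ 0)
    (hu : ∀ x ∈ U, p x + r x * g x (X x) (X x) ≠ 0) (hx : x ∈ U) (w v : TangentSpace 𝓘(ℝ, E) x) :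
    deformed g I J K X p r x (deformInv (g x) (I x) (J x) (K x) (X x) (p x) (r x) w) v =
      g x w v :=
  (h.hyperHermitian x).deformInv_dual (hp x hx) (hu x hx) w v

lemma deformed_symm (u v : TangentSpace 𝓘(ℝ, E) x) :
    deformed g I J K X p r x u v = deformed g I J K X p r x v u := by
  rw [deformed_apply, deformed_apply, (h.hyperHermitian x).symm u v]
  ring

lemma isHKTConnectionOn_deformed (hd : IsDeformationOn g X a b p r s U)
    (hp : ∀ x ∈ U, p x ≠ 0)
    (hu : ∀ x ∈ U, p x + r x * g x (X x) (X x) ≠ 0) [T2Space M] :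
    IsHKTConnectionOn (h.deformedConnection p r s) (deformed g I J K X p r) I J K U where
  connection := h.isCovariantDerivativeOn_deformedConnection
  smooth := h.contMDiff_deformedConnection hd hp hu
  metric x hx Y Z hY hZ v := by
    have h1 := (h.model x).preChange_metric (a := a) (b := b) (r := r x) (s := s x) v (Y x) (Z x)
    rw [(h.hyperHermitian x).symm (Y x)] at h1
    have h2 : ∀ w, deformed g I J K X p r x (Y x)
        (deformInv (g x) (I x) (J x) (K x) (X x) (p x) (r x) w) = g x w (Y x) := fun w ↦ by
      rw [h.deformed_symm, h.deformed_deformInv hp hu hx]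
    rw [h.d_deformed hd hx hY hZ, deformedConnection_apply, deformedConnection_apply, map_add,
      map_add, add_apply, h.deformed_deformInv hp hu hx, h2]
    linarith
  parallelI x _ Y hY v := h.deformedConnection_parallelI hY v
  parallelJ x _ Y hY v := by
    rw [← h.deformedConnection_rotate]
    exact h.rotate.deformedConnection_parallelI hY v
  parallelK x _ Y hY v := by
    rw [← h.deformedConnection_rotate, ← h.rotate.deformedConnection_rotate]
    exact h.rotate.rotate.deformedConnection_parallelI hY v
  skew_left x hx W Y Z hW hY hZ := by
    have h1 := (h.model x).preChange_skew (p := p x) (r := r x) (s := s x) (W x) (Y x) (Z x)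
    have h2 : ∀ {W' Y' : VField E M}, DiffAt Y' x →
        torsionForm (deformed g I J K X p r) (h.deformedConnection p r s) W' Y' Z x =
          deformed g I J K X p r x (W' x) (h.tor x (Y' x) (Z x))
          + g x (preChange (g x) (I x) (J x) (K x) (h.tor x) (X x) a b (r x) (s x) (Z x) (Y' x))
            (W' x)
          - g x (preChange (g x) (I x) (J x) (K x) (h.tor x) (X x) a b (r x) (s x) (Y' x) (Z x))
            (W' x) := by
      intro W' Y' hY'
      rw [torsionForm, BilinField.app, torsion, h.bracket_eq hY' hZ, deformedConnection_apply,
        deformedConnection_apply, ← h.deformed_deformInv hp hu hx,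
        ← h.deformed_deformInv hp hu hx, h.deformed_symm _ (W' x), h.deformed_symm _ (W' x),
        ← map_add, ← map_sub]
      congr 1
      abel
    rw [h2 hY, h2 hW]
    exact h1
  skew_right x hx W Y Z hW hY hZ := by
    have : torsion (h.deformedConnection p r s) Y Z x =
        -torsion (h.deformedConnection p r s) Z Y x := by
      rw [torsion, torsion, h.bracket_eq hY hZ, h.bracket_eq hZ hY, h.tor_swap (Z x)]
      abel
    rw [torsionForm, torsionForm, BilinField.app, BilinField.app, this, map_neg]

lemma isHermitianOn_deformed : IsHermitianOn (deformed g I J K X p r) I U := by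
  intro x _ v w
  have hh := h.hyperHermitian x
  simp only [deformed_apply, hh.skewI, hh.II, hh.IJ, hh.IK, map_neg, neg_apply, neg_neg]
  ring

/-- The deformed metric is HKT wherever it is nondegenerate. -/
lemma isHKTOn_deformed (hd : IsDeformationOn g X a b p r s U)
    (hp : ∀ x ∈ U, p x ≠ 0)
    (hu : ∀ x ∈ U, p x + r x * g x (X x) (X x) ≠ 0) [T2Space M] :
    IsHKTOn (deformed g I J K X p r) I J K U where
  hypercomplex := h.hkt.hypercomplex.mono (Set.subset_univ _)
  metric :=
    { smooth := BilinField.smoothOn_of_app fun x hx Y Z hY hZ ↦ h.fsmAt_deformed hd hx hY hZ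
      symm := fun x _ ↦ h.deformed_symm
      nondegenerate := fun x hx v hv ↦ (h.hyperHermitian x).nondeg v fun w ↦ by
        rw [(h.hyperHermitian x).symm, ← h.deformed_deformInv hp hu hx, h.deformed_symm, hv] }
  hermitianI := h.isHermitianOn_deformed
  hermitianJ := by
    rw [← deformed_rotate]
    exact h.rotate.isHermitianOn_deformed
  hermitianK := by
    rw [← deformed_rotate, ← deformed_rotate]
    exact h.rotate.rotate.isHermitianOn_deformed
  exists_connection := ⟨_, h.isHKTConnectionOn_deformed hd hp hu⟩

lemma isPotentialOn_deformed (hd : IsDeformationOn g X a b p r s U) {φ : M → ℝ}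
    (hs : ContMDiffOn 𝓘(ℝ, E) 𝓘(ℝ, ℝ) ∞ φ U)
    (hφ : ∀ x ∈ U, ∀ v, d φ x v = 2 / (a - b) * p x * g x (X x) v) :
    IsPotentialOn φ (deformed g I J K X p r) I J K U where
  smooth := hs
  eqI := h.potentialEqOn_deformed hd hφ
  eqJ := by
    rw [← deformed_rotate]
    exact h.rotate.potentialEqOn_deformed hd hφ
  eqK := by
    rw [← deformed_rotate, ← deformed_rotate]
    exact h.rotate.rotate.potentialEqOn_deformed hd hφ

lemma isSpecialHomothetyOn_deformed (hd : IsDeformationOn g X a b p r s U) {a' : ℝ}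
    (h1 : ∀ x ∈ U, (a - b) * r x * g x (X x) (X x) + a * p x = a' * p x)
    (h2 : ∀ x ∈ U, s x * g x (X x) (X x) + 2 * a * r x = a' * r x) :
    IsSpecialHomothetyOn X (deformed g I J K X p r) I J K a' b U where
  smooth := ContMDiffOn.mono h.hom.smooth (Set.subset_univ _)
  lie_X_g x hx Y Z hY hZ := by
    rw [h.lieBilin_X_deformed hd hx hY hZ, h1 x hx, h2 x hx, deformed_apply, quatSquare_apply]
    ring
  lie_IX_g := h.lieBilin_IX_deformed hd
  lie_JX_g := by
    rw [← deformed_rotate]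
    exact h.rotate.lieBilin_IX_deformed hd
  lie_KX_g := by
    rw [← deformed_rotate, ← deformed_rotate]
    exact h.rotate.rotate.lieBilin_IX_deformed hd
  lie_IX_I x _ := h.hom.lie_IX_I x trivial
  lie_JX_J x _ := h.hom.lie_JX_J x trivial
  lie_KX_K x _ := h.hom.lie_KX_K x trivial
  lie_IX_J x _ := h.hom.lie_IX_J x trivial
  lie_JX_K x _ := h.hom.lie_JX_K x trivial
  lie_KX_I x _ := h.hom.lie_KX_I x trivial

end HomothetySetting

end

/-! ### Functions of the potential -/

section

lemma contDiffAt_deriv {f : ℝ → ℝ} {t : ℝ} (hf : ContDiffAt ℝ ∞ f t) :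
    ContDiffAt ℝ ∞ (deriv f) t := by
  have := (hf.fderiv_right (m := ∞) (by simp)).clm_apply (contDiffAt_const (c := (1 : ℝ)))
  simpa only [fderiv_apply_one_eq_deriv] using this

/-- The function `f` is smooth away from `0` and there it satisfies `t f''(t) = (k - 1) f'(t)` with
`f' ≠ 0`, as do `|t| ^ k` for `k ≠ 0` and `log |t|` for `k = 0`. -/
structure IsPowerLike (f : ℝ → ℝ) (k : ℝ) : Prop where
  smooth : ∀ t ≠ 0, ContDiffAt ℝ ∞ f t
  ode : ∀ t ≠ 0, t * deriv (deriv f) t = (k - 1) * deriv f t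
  deriv_ne : ∀ t ≠ 0, deriv f t ≠ 0

/-- If `f' = c |t| ^ k / t` away from `0`, then `f` is power-like. -/
lemma isPowerLike_of_deriv {f : ℝ → ℝ} {k c : ℝ} (hc : c ≠ 0)
    (hs : ∀ t ≠ 0, ContDiffAt ℝ ∞ f t)
    (hf : ∀ t ≠ 0, deriv f t = c * (Real.exp (Real.log t * k) / t)) : IsPowerLike f k where
  smooth := hs
  ode t ht := by
    have h1 : deriv f =ᶠ[𝓝 t] fun t ↦ c * (Real.exp (Real.log t * k) / t) := by
      filter_upwards [isOpen_ne.mem_nhds ht] with y hy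
      exact hf y hy
    have h2 : HasDerivAt (fun t ↦ c * (Real.exp (Real.log t * k) / t)) _ t :=
      ((((Real.hasDerivAt_log ht).mul_const k).exp).div (hasDerivAt_id t) ht).const_mul c
    rw [h1.deriv_eq, h2.deriv, hf t ht]
    simp only [id]
    field_simp
  deriv_ne t ht := by
    rw [hf t ht]
    exact mul_ne_zero hc (div_ne_zero (Real.exp_ne_zero _) ht)

lemma isPowerLike_rpow {k : ℝ} (hk : k ≠ 0) : IsPowerLike (fun t ↦ |t| ^ k) k := by
  have h1 : ∀ t ≠ 0, (fun t : ℝ ↦ |t| ^ k) =ᶠ[𝓝 t] fun t ↦ Real.exp (Real.log t * k) := by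
    intro t ht
    filter_upwards [isOpen_ne.mem_nhds ht] with y hy
    rw [Real.rpow_def_of_pos (abs_pos.2 hy), Real.log_abs]
  refine isPowerLike_of_deriv hk (fun t ht ↦ ?_) fun t ht ↦ ?_
  · refine ContDiffAt.congr_of_eventuallyEq ?_ (h1 t ht)
    exact ((Real.contDiffAt_log.2 ht).mul contDiffAt_const).exp
  · rw [(h1 t ht).deriv_eq, (((Real.hasDerivAt_log ht).mul_const k).exp).deriv]
    field_simp

lemma isPowerLike_log : IsPowerLike (fun t ↦ Real.log |t|) 0 := by
  simp only [Real.log_abs]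
  refine isPowerLike_of_deriv one_ne_zero (fun t ht ↦ Real.contDiffAt_log.2 ht) fun t ht ↦ ?_
  rw [Real.deriv_log]
  simp

/-- The derivative of the equation `t f'' = (k - 1) f'`. -/
lemma IsPowerLike.ode_deriv {f : ℝ → ℝ} {k : ℝ} (hf : IsPowerLike f k) {t : ℝ} (ht : t ≠ 0) :
    t * deriv (deriv (deriv f)) t = (k - 2) * deriv (deriv f) t := by
  have h1 := contDiffAt_deriv (hf.smooth t ht)
  have h2 := (contDiffAt_deriv h1).differentiableAt (by simp)
  have he : (fun t ↦ t * deriv (deriv f) t) =ᶠ[𝓝 t] fun t ↦ (k - 1) * deriv f t := by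
    filter_upwards [isOpen_ne.mem_nhds ht] with y hy
    exact hf.ode y hy
  have h3 := he.deriv_eq
  have h4 : deriv (fun t ↦ t * deriv (deriv f) t) t =
      1 * deriv (deriv f) t + t * deriv (deriv (deriv f)) t :=
    ((hasDerivAt_id' t).mul h2.hasDerivAt).deriv
  rw [h4, ((h1.differentiableAt (by simp)).hasDerivAt.const_mul (k - 1)).deriv] at h3
  linarith

/-- Two solutions of `t w' = (k - 1) w` without zeros on an interval that does not contain `0` are
proportional. -/
lemma exists_const_mul_of_ode {k : ℝ} {C : Set ℝ} (hC : IsPreconnected C) (h0 : ∀ t ∈ C, t ≠ 0)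
    {w w₀ : ℝ → ℝ} (hw : ∀ t ∈ C, DifferentiableAt ℝ w t) (hw₀ : ∀ t ∈ C, DifferentiableAt ℝ w₀ t)
    (ode : ∀ t ∈ C, t * deriv w t = (k - 1) * w t)
    (ode₀ : ∀ t ∈ C, t * deriv w₀ t = (k - 1) * w₀ t)
    (hn : ∀ t ∈ C, w t ≠ 0) (hn₀ : ∀ t ∈ C, w₀ t ≠ 0) :
    ∃ A : ℝ, A ≠ 0 ∧ ∀ t ∈ C, w t = A * w₀ t := by
  rcases C.eq_empty_or_nonempty with rfl | ⟨t₀, ht₀⟩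
  · exact ⟨1, one_ne_zero, by simp⟩
  refine ⟨w t₀ / w₀ t₀, div_ne_zero (hn _ ht₀) (hn₀ _ ht₀), fun t ht ↦ ?_⟩
  -- The quotient of the two solutions has zero derivative.
  have hd : ∀ t ∈ C, HasDerivAt (fun t ↦ w t / w₀ t) 0 t := by
    intro t ht
    have h1 := (hw t ht).hasDerivAt.div (hw₀ t ht).hasDerivAt (hn₀ t ht)
    have h2 : deriv w t * w₀ t - w t * deriv w₀ t = 0 := by
      refine (mul_eq_zero.1 (?_ : t * _ = 0)).resolve_left (h0 t ht)
      linear_combination w₀ t * ode t ht - w t * ode₀ t ht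
    rwa [h2, zero_div] at h1
  have hc : w t / w₀ t = w t₀ / w₀ t₀ := by
    have := hC.ordConnected.convex.norm_image_sub_le_of_norm_hasDerivWithin_le (C := 0)
      (fun t ht ↦ (hd t ht).hasDerivWithinAt) (by simp) ht₀ ht
    rw [zero_mul] at this
    exact sub_eq_zero.1 (norm_le_zero_iff.1 this)
  rw [← hc, div_mul_cancel₀ _ (hn₀ t ht)]

variable {E : Type*} [NormedAddCommGroup E] [NormedSpace ℝ E]
  {M : Type*} [TopologicalSpace M] [ChartedSpace E M] [IsManifold 𝓘(ℝ, E) ∞ M]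
  {g : BilinField E M} {I J K : EndField E M} {X : VField E M} {a b : ℝ} {U : Set M}
  {nabla : ConnectionOp E M} {x : M}

/-- The coefficient `p = f'(μ)` of `g_f`. -/
def coeffP (X : VField E M) (g : BilinField E M) (a b : ℝ) (f : ℝ → ℝ) : M → ℝ :=
  fun x ↦ deriv f (potentialOf X g a b x)

/-- The coefficient `r` of `∑ (Aᵢ X)♭ ⊗ (Aᵢ X)♭` in `g_f`, which comes from `½ f''(μ)` by
`dμ = 2 / (a - b) X♭`. -/
def coeffR (X : VField E M) (g : BilinField E M) (a b : ℝ) (f : ℝ → ℝ) : M → ℝ :=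
  fun x ↦ (2 / (a - b)) ^ 2 / 2 * deriv (deriv f) (potentialOf X g a b x)

/-- The coefficient `s` in `dr = s X♭`. -/
def coeffS (X : VField E M) (g : BilinField E M) (a b : ℝ) (f : ℝ → ℝ) : M → ℝ :=
  fun x ↦ (2 / (a - b)) ^ 3 / 2 * deriv (deriv (deriv f)) (potentialOf X g a b x)

namespace HomothetySetting

variable [FiniteDimensional ℝ E] [CompleteSpace E]
  (h : HomothetySetting nabla g I J K X a b)
include h

lemma fsmAt_comp_potentialOf {f : ℝ → ℝ} (hf : ContDiffAt ℝ ∞ f (potentialOf X g a b x)) :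
    FSmAt E (fun y ↦ f (potentialOf X g a b y)) x :=
  ContMDiffAt.comp x hf.contMDiffAt (h.fsmAt_potentialOf x)

lemma d_comp_potentialOf {f : ℝ → ℝ} (hf : ContDiffAt ℝ ∞ f (potentialOf X g a b x))
    (v : TangentSpace 𝓘(ℝ, E) x) :
    d (fun y ↦ f (potentialOf X g a b y)) x v =
      2 / (a - b) * deriv f (potentialOf X g a b x) * g x (X x) v := by
  rw [d_comp (hf.differentiableAt (by simp)) ((h.fsmAt_potentialOf x).mdifferentiableAt (by simp)),
    h.d_potentialOf]
  ring

lemma transformed_eq (f : ℝ → ℝ) : transformed g I J K (potentialOf X g a b) f =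
    deformed g I J K X (coeffP X g a b f) (coeffR X g a b f) := by
  funext x
  ext u v
  have hh := h.hyperHermitian x
  simp only [transformed, dHSquare, OneForm.square, twist, add_apply, smul_apply,
    ContinuousLinearMap.smulRight_apply, neg_apply, ContinuousLinearMap.comp_apply,
    h.d_potentialOf, deformed_apply, coeffP, coeffR, hh.skewI, hh.skewJ, hh.skewK, smul_eq_mul]
  ring

lemma isDeformationOn {f : ℝ → ℝ} (hU : IsOpen U)
    (hf : ∀ x ∈ U, ContDiffAt ℝ ∞ f (potentialOf X g a b x)) :
    IsDeformationOn g X a b (coeffP X g a b f) (coeffR X g a b f) (coeffS X g a b f) U where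
  isOpen := hU
  smooth_p x hx := h.fsmAt_comp_potentialOf (contDiffAt_deriv (hf x hx))
  smooth_r x hx := contMDiffAt_const.mul
    (h.fsmAt_comp_potentialOf (contDiffAt_deriv (contDiffAt_deriv (hf x hx))))
  smooth_s x hx := contMDiffAt_const.mul
    (h.fsmAt_comp_potentialOf (contDiffAt_deriv (contDiffAt_deriv (contDiffAt_deriv (hf x hx)))))
  d_p x hx v := by
    have hb := sub_ne_zero.2 h.hab
    have h1 := contDiffAt_deriv (hf x hx)
    have h2 : d (coeffP X g a b f) x v = _ := h.d_comp_potentialOf h1 v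
    rw [h2, coeffR]
    field_simp
  d_r x hx v := by
    have h1 := contDiffAt_deriv (contDiffAt_deriv (hf x hx))
    have h2 : d (coeffR X g a b f) x v = _ := d_const_mul ((2 / (a - b)) ^ 2 / 2)
      ((h.fsmAt_comp_potentialOf h1).mdifferentiableAt (by simp)) v
    rw [h2, h.d_comp_potentialOf h1, coeffS]
    ring

lemma isPotentialOn_transformed {f : ℝ → ℝ} (hU : IsOpen U)
    (hf : ∀ x ∈ U, ContDiffAt ℝ ∞ f (potentialOf X g a b x)) :
    IsPotentialOn (fun x ↦ f (potentialOf X g a b x))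
      (transformed g I J K (potentialOf X g a b) f) I J K U := by
  rw [h.transformed_eq]
  exact h.isPotentialOn_deformed (h.isDeformationOn hU hf)
    (fun x hx ↦ (h.fsmAt_comp_potentialOf (hf x hx)).contMDiffWithinAt)
    fun x hx v ↦ h.d_comp_potentialOf (hf x hx) v

lemma gXX_eq (x : M) : g x (X x) (X x) = a * (a - b) / 2 * potentialOf X g a b x := by
  have := h.ha
  have := sub_ne_zero.2 h.hab
  rw [potentialOf]
  field_simp

lemma isOpen_potentialOf_ne_zero : IsOpen {x | potentialOf X g a b x ≠ 0} :=
  isOpen_ne.preimage (continuous_iff_continuousAt.2 fun x ↦ (h.fsmAt_potentialOf x).continuousAt)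

lemma coeffR_mul_gXX (f : ℝ → ℝ) (x : M) :
    coeffR X g a b f x * g x (X x) (X x) = a / (a - b) *
      (potentialOf X g a b x * deriv (deriv f) (potentialOf X g a b x)) := by
  have := sub_ne_zero.2 h.hab
  rw [h.gXX_eq, coeffR]
  field_simp

lemma coeffS_mul_gXX (f : ℝ → ℝ) (x : M) :
    coeffS X g a b f x * g x (X x) (X x) = a * (2 / (a - b)) ^ 2 / 2 *
      (potentialOf X g a b x * deriv (deriv (deriv f)) (potentialOf X g a b x)) := by
  have := sub_ne_zero.2 h.hab
  rw [h.gXX_eq, coeffS]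
  field_simp

/-- A power-like function of the potential yields an HKT metric with the same homothety. -/
lemma hasPotentialAndHomothetyOn_transformed [T2Space M] {f : ℝ → ℝ} {k : ℝ}
    (hf : IsPowerLike f k) (hk : k ≠ b / a) :
    HasPotentialAndHomothetyOn (transformed g I J K (potentialOf X g a b) f) I J K X
      (fun x ↦ f (potentialOf X g a b x)) (k * a) b {x | potentialOf X g a b x ≠ 0} := by
  have hU := h.isOpen_potentialOf_ne_zero
  have hfs : ∀ x ∈ {x | potentialOf X g a b x ≠ 0}, ContDiffAt ℝ ∞ f (potentialOf X g a b x) :=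
    fun x hx ↦ hf.smooth _ hx
  have hd := h.isDeformationOn hU hfs
  have ha := h.ha
  have hb := sub_ne_zero.2 h.hab
  refine ⟨?_, h.isPotentialOn_transformed hU hfs, ?_⟩
  · rw [h.transformed_eq]
    refine h.isHKTOn_deformed hd (fun x hx ↦ hf.deriv_ne _ hx) fun x hx ↦ ?_
    rw [h.coeffR_mul_gXX, hf.ode _ hx, coeffP]
    have h1 : deriv f (potentialOf X g a b x)
        + a / (a - b) * ((k - 1) * deriv f (potentialOf X g a b x)) =
        deriv f (potentialOf X g a b x) * ((k * a - b) / (a - b)) := by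
      field_simp
      ring
    rw [h1]
    refine mul_ne_zero (hf.deriv_ne _ hx) (div_ne_zero (fun h0 ↦ hk ?_) hb)
    rw [eq_div_iff ha]
    linarith
  · rw [h.transformed_eq]
    refine h.isSpecialHomothetyOn_deformed hd (fun x hx ↦ ?_) fun x hx ↦ ?_
    · rw [mul_assoc, h.coeffR_mul_gXX, hf.ode _ hx, coeffP]
      field_simp
      ring
    · rw [h.coeffS_mul_gXX, hf.ode_deriv hx, coeffR]
      ring

end HomothetySetting

end

/-! ### Equations for the unknown function -/

section

section Pointwise

variable {V : Type*} [AddCommGroup V] [Module ℝ V] [TopologicalSpace V] [IsTopologicalAddGroup V]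
  [ContinuousSMul ℝ V] {g : V →L[ℝ] V →L[ℝ] ℝ} {I J K : V →L[ℝ] V} {X : V}

/-- The linear map `v ↦ (g(X, v), g(I X, v), g(J X, v), g(K X, v))`. -/
def quatCoord (g : V →L[ℝ] V →L[ℝ] ℝ) (I J K : V →L[ℝ] V) (X : V) : V →ₗ[ℝ] Fin 4 → ℝ :=
  LinearMap.pi ![(g X).toLinearMap, (g (I X)).toLinearMap, (g (J X)).toLinearMap,
    (g (K X)).toLinearMap]

lemma quatCoord_eq_zero_iff (v : V) : quatCoord g I J K X v = 0 ↔
    g X v = 0 ∧ g (I X) v = 0 ∧ g (J X) v = 0 ∧ g (K X) v = 0 := by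
  simp [quatCoord, funext_iff, Fin.forall_fin_succ]

lemma HyperHermitian.g_IX_X (h : HyperHermitian g I J K) : g (I X) X = 0 := by
  have := h.skewI X X; rw [h.symm X] at this; linarith

lemma HyperHermitian.quatCoord_surjective (h : HyperHermitian g I J K) (hX : g X X ≠ 0) :
    Function.Surjective (quatCoord g I J K X) := by
  intro y
  have e1 := h.g_IX_X (X := X)
  have e2 := h.rotate.g_IX_X (X := X)
  have e3 := h.rotate.rotate.g_IX_X (X := X)
  refine ⟨(g X X)⁻¹ • (y 0 • X + y 1 • I X + y 2 • J X + y 3 • K X), ?_⟩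
  funext i
  fin_cases i <;>
  simp [quatCoord, h.skewI, h.skewJ, h.skewK, h.II, h.JJ, h.KK, h.IJ, h.JI, h.JK, h.KJ, h.KI, h.IK,
    e1, e2, e3] <;> field_simp

variable [FiniteDimensional ℝ V]

/-- In dimension more than four some nonzero vector is orthogonal to `X`, `I X`, `J X`, `K X`. -/
lemma exists_quatCoord_eq_zero (hV : 4 < Module.finrank ℝ V) :
    ∃ v ≠ 0, quatCoord g I J K X v = 0 := by
  have := LinearMap.ker_ne_bot_of_finrank_lt (f := quatCoord g I J K X) (by simpa using hV)
  obtain ⟨v, hv, h0⟩ := (Submodule.ne_bot_iff _).1 this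
  exact ⟨v, h0, hv⟩

/-- In dimension four `X`, `I X`, `J X`, `K X` is an orthogonal basis if `g(X, X) ≠ 0`. -/
lemma HyperHermitian.quatSquare_eq (h : HyperHermitian g I J K) (hX : g X X ≠ 0)
    (hV : Module.finrank ℝ V = 4) (u v : V) : quatSquare g I J K X u v = g X X * g u v := by
  have e1 := h.g_IX_X (X := X)
  have e2 := h.rotate.g_IX_X (X := X)
  have e3 := h.rotate.rotate.g_IX_X (X := X)
  have hinj : Function.Injective (quatCoord g I J K X) :=
    (LinearMap.injective_iff_surjective_of_finrank_eq_finrank (by simpa using hV)).2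
      (h.quatCoord_surjective hX)
  have hp : quatProj g I J K X u = g X X • u := by
    rw [← sub_eq_zero]
    refine hinj ?_
    rw [map_zero, quatCoord_eq_zero_iff]
    refine ⟨?_, ?_, ?_, ?_⟩ <;>
    simp only [quatProj_apply, map_sub, map_add, map_smul, h.skewI, h.skewJ, h.skewK, h.II, h.JJ,
      h.KK, h.IJ, h.JI, h.JK, h.KJ, h.KI, h.IK, e1, e2, e3, smul_eq_mul, map_neg, neg_apply] <;>
    ring
  have : quatSquare g I J K X u v = g (quatProj g I J K X u) v := by
    simp
  rw [this, hp, map_smul, smul_apply, smul_eq_mul]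

end Pointwise

variable {E : Type*} [NormedAddCommGroup E] [NormedSpace ℝ E]
  {M : Type*} [TopologicalSpace M] [ChartedSpace E M] [IsManifold 𝓘(ℝ, E) ∞ M]
  {g : BilinField E M} {I J K : EndField E M} {X : VField E M} {a b : ℝ} {U : Set M}
  {nabla : ConnectionOp E M} {x : M}

lemma lieBilin_congr {V Y Z : VField E M} {g₁ g₂ : BilinField E M} (hU : IsOpen U)
    (hg : ∀ y ∈ U, g₁ y = g₂ y) (hx : x ∈ U) : lieBilin V g₁ Y Z x = lieBilin V g₂ Y Z x := by
  have : d (E := E) (g₁.app Y Z) x = d (g₂.app Y Z) x := d_congr <| by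
    filter_upwards [hU.mem_nhds hx] with y hy
    rw [BilinField.app, BilinField.app, hg y hy]
  rw [lieBilin, lieBilin, this, hg x hx]

/-- An HKT metric is determined by its potential. -/
lemma PotentialEqOn.eq [FiniteDimensional ℝ E] {φ : M → ℝ} {g₁ g₂ : BilinField E M}
    (h₁ : PotentialEqOn φ g₁ I J K U) (h₂ : PotentialEqOn φ g₂ I J K U)
    (hI : ∀ x ∈ U, ∀ v, I x (I x v) = -v) (hx : x ∈ U) : g₁ x = g₂ x := by
  ext u v
  have h1 := h₁ x hx (extend (-I x u)) (extend v) (diffAt_extend _) (diffAt_extend _)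
  rw [← h₂ x hx (extend (-I x u)) (extend v) (diffAt_extend _) (diffAt_extend _)] at h1
  simpa only [extend_self, map_neg, hI x hx, neg_neg] using h1

namespace HomothetySetting

variable [FiniteDimensional ℝ E] [CompleteSpace E]
  (h : HomothetySetting nabla g I J K X a b)
include h

/-- If `μ` vanished identically, so would `X`, contradicting `∇X = a/2`. -/
lemma exists_potentialOf_ne_zero [Nonempty M] [Nontrivial E] : ∃ x, potentialOf X g a b x ≠ 0 := by
  by_contra! hc
  have hb := sub_ne_zero.2 h.hab
  obtain ⟨x⟩ := ‹Nonempty M›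
  have hX : X = 0 := by
    funext y
    refine (h.hyperHermitian y).nondeg _ fun v ↦ ?_
    have h1 := h.d_potentialOf (x := y) v
    rw [funext hc] at h1
    have h2 : d (fun _ : M ↦ (0 : ℝ)) y v = 0 := by simp [d, mvfderiv_const]
    rw [h2] at h1
    exact (mul_eq_zero.1 h1.symm).resolve_left (div_ne_zero two_ne_zero hb)
  obtain ⟨v, hv⟩ := exists_ne (0 : E)
  have h1 := h.nabla_X (x := x) v
  rw [hX, h.conn.connection.zero] at h1
  exact hv ((smul_eq_zero.1 h1.symm).resolve_left (div_ne_zero h.ha two_ne_zero))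

lemma gXX_ne_zero (hx : potentialOf X g a b x ≠ 0) : g x (X x) (X x) ≠ 0 := by
  have hb := sub_ne_zero.2 h.hab
  rw [h.gXX_eq]
  exact mul_ne_zero (div_ne_zero (mul_ne_zero h.ha hb) two_ne_zero) hx

section
variable {f : ℝ → ℝ} {a' b' : ℝ} {g' : BilinField E M}
  (hU : U = {x | potentialOf X g a b x ≠ 0})
  (hf : ∀ x ∈ U, ContDiffAt ℝ ∞ f (potentialOf X g a b x))
  (hg : HasPotentialAndHomothetyOn g' I J K X (fun x ↦ f (potentialOf X g a b x)) a' b' U)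
include hU hf hg

lemma eq_deformed (hx : x ∈ U) :
    g' x = deformed g I J K X (coeffP X g a b f) (coeffR X g a b f) x := by
  rw [← h.transformed_eq]
  exact hg.potential.eqI.eq (h.isPotentialOn_transformed
    (hU ▸ h.isOpen_potentialOf_ne_zero) hf).eqI hg.hkt.hypercomplex.complexI.sq hx

/-- The homothety equation `L_X g' = a' g'` in terms of `f`. -/
lemma homothety_eq (hx : x ∈ U) (u v : TangentSpace 𝓘(ℝ, E) x) :
    ((a - b) * coeffR X g a b f x * g x (X x) (X x) + (a - a') * coeffP X g a b f x) * g x u v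
      + (coeffS X g a b f x * g x (X x) (X x) + (2 * a - a') * coeffR X g a b f x)
        * quatSquare (g x) (I x) (J x) (K x) (X x) u v = 0 := by
  have ho : IsOpen U := hU ▸ h.isOpen_potentialOf_ne_zero
  have h1 := hg.homothety.lie_X_g x hx (extend u) (extend v) (diffAt_extend _) (diffAt_extend _)
  rw [lieBilin_congr ho (fun y ↦ h.eq_deformed hU hf hg) hx,
    h.lieBilin_X_deformed (h.isDeformationOn ho hf) hx (diffAt_extend _) (diffAt_extend _),
    h.eq_deformed hU hf hg hx, deformed_apply] at h1
  simp only [extend_self, quatSquare_apply] at h1 ⊢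
  linarith

/-- Nondegeneracy of `g'` on the quaternionic span of `X`. -/
lemma coeff_ne_zero (hx : x ∈ U) : deriv f (potentialOf X g a b x) + a / (a - b) *
    (potentialOf X g a b x * deriv (deriv f) (potentialOf X g a b x)) ≠ 0 := by
  rw [← h.coeffR_mul_gXX]
  intro h0
  have hh := h.hyperHermitian x
  have hX : X x = 0 := by
    refine hg.hkt.metric.nondegenerate x hx _ fun w ↦ ?_
    rw [h.eq_deformed hU hf hg hx, deformed_apply, hh.g_IX_X, hh.rotate.g_IX_X,
      hh.rotate.rotate.g_IX_X, coeffP]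
    linear_combination g x (X x) w * h0
  refine h.gXX_ne_zero (hU.subset hx) ?_
  rw [hX, map_zero]

/-- In dimension at least eight the homothety equation is an equation for `f'`. -/
lemma ode_of_four_lt (hE : 4 < Module.finrank ℝ E) (hx : x ∈ U) :
    potentialOf X g a b x * deriv (deriv f) (potentialOf X g a b x) =
      (a' / a - 1) * deriv f (potentialOf X g a b x) := by
  have hb := sub_ne_zero.2 h.hab
  have : FiniteDimensional ℝ (TangentSpace 𝓘(ℝ, E) x) := inferInstanceAs (FiniteDimensional ℝ E)
  obtain ⟨v, hv, h0⟩ := exists_quatCoord_eq_zero (g := g x) (I := I x) (J := J x) (K := K x)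
    (X := X x) hE
  rw [quatCoord_eq_zero_iff] at h0
  have h1 : (a - b) * coeffR X g a b f x * g x (X x) (X x)
      + (a - a') * coeffP X g a b f x = 0 := by
    by_contra hn
    refine hv ((h.hyperHermitian x).nondeg v fun w ↦ ?_)
    have := h.homothety_eq hU hf hg hx v w
    rw [quatSquare_apply, h0.1, h0.2.1, h0.2.2.1, h0.2.2.2] at this
    simpa [hn] using this
  rw [mul_assoc, h.coeffR_mul_gXX, coeffP] at h1
  have ha := h.ha
  field_simp at h1 ⊢
  linarith

/-- In every dimension the homothety equation on `X` is an equation for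
`f' + a / (a - b) t f''`, the factor by which `g'` differs from `g` on the quaternionic span
of `X`. -/
lemma ode_on_span (hx : x ∈ U) :
    potentialOf X g a b x * deriv (fun t ↦ deriv f t + a / (a - b) * (t * deriv (deriv f) t))
        (potentialOf X g a b x) =
      (a' / a - 1) * (deriv f (potentialOf X g a b x) + a / (a - b) *
        (potentialOf X g a b x * deriv (deriv f) (potentialOf X g a b x))) := by
  have ha := h.ha
  have hb := sub_ne_zero.2 h.hab
  have hN := h.gXX_ne_zero (hU.subset hx)
  have hh := h.hyperHermitian x
  have h1 := h.homothety_eq hU hf hg hx (X x) (X x)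
  rw [quatSquare_apply, hh.g_IX_X, hh.rotate.g_IX_X, hh.rotate.rotate.g_IX_X] at h1
  have h2 : (a - b) * (coeffR X g a b f x * g x (X x) (X x)) + (a - a') * coeffP X g a b f x
      + (coeffS X g a b f x * g x (X x) (X x)) * g x (X x) (X x)
      + (2 * a - a') * (coeffR X g a b f x * g x (X x) (X x)) = 0 := by
    refine (mul_eq_zero.1 (?_ : g x (X x) (X x) * _ = 0)).resolve_left hN
    linear_combination h1
  rw [h.coeffR_mul_gXX, h.coeffS_mul_gXX, h.gXX_eq, coeffP] at h2
  set t := potentialOf X g a b x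
  have d1 := contDiffAt_deriv (hf x hx)
  have d2 := contDiffAt_deriv d1
  have hd : HasDerivAt (fun t ↦ deriv f t + a / (a - b) * (t * deriv (deriv f) t))
      (deriv (deriv f) t +
        a / (a - b) * (1 * deriv (deriv f) t + t * deriv (deriv (deriv f)) t)) t :=
    (d1.differentiableAt (by simp)).hasDerivAt.add
      (((hasDerivAt_id' t).mul (d2.differentiableAt (by simp)).hasDerivAt).const_mul _)
  rw [hd.deriv]
  field_simp at h2 ⊢
  linarith

/-- Uniqueness of the second type. -/
lemma type_snd_eq (hx : x ∈ U) [Nontrivial E] : b' = b := by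
  have : Nontrivial (TangentSpace 𝓘(ℝ, E) x) := inferInstanceAs (Nontrivial E)
  obtain ⟨v, hv⟩ := exists_ne (0 : TangentSpace 𝓘(ℝ, E) x)
  have h1 := hg.homothety.lie_IX_J x hx (extend v) (diffAt_extend _)
  rw [h.hom.lie_IX_J x trivial (extend v) (diffAt_extend _), extend_self] at h1
  refine (smul_left_injective ℝ (m := K x v) (fun h0 ↦ hv ?_) h1).symm
  have := (h.hyperHermitian x).KK v
  rw [h0, map_zero] at this
  exact neg_eq_zero.1 this.symm

end
end HomothetySetting

end

/-! ### Comparison with the model functions -/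

section

variable {E : Type*} [NormedAddCommGroup E] [NormedSpace ℝ E]
  {M : Type*} [TopologicalSpace M] [ChartedSpace E M] [IsManifold 𝓘(ℝ, E) ∞ M]
  {g : BilinField E M} {I J K : EndField E M} {X : VField E M} {a b : ℝ} {U : Set M}
  {nabla : ConnectionOp E M} {x : M}

namespace HomothetySetting

variable [FiniteDimensional ℝ E] [CompleteSpace E]
  (h : HomothetySetting nabla g I J K X a b)
include h

variable {f f₀ : ℝ → ℝ} {a' b' : ℝ} {g' : BilinField E M}
  (hU : U = {x | potentialOf X g a b x ≠ 0})
  (hf : ∀ x ∈ U, ContDiffAt ℝ ∞ f (potentialOf X g a b x))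
  (hg : HasPotentialAndHomothetyOn g' I J K X (fun x ↦ f (potentialOf X g a b x)) a' b' U)
  (hf₀ : IsPowerLike f₀ (a' / a))
include hU hf hg hf₀

/-- In dimension greater than four `f'` and `f₀'` solve the same equation. -/
lemma homothetic_of_four_lt (hE : 4 < Module.finrank ℝ E) :
    HomotheticOverIntervals g' (transformed g I J K (potentialOf X g a b) f₀)
      (potentialOf X g a b) U := by
  intro C hC hpre
  have hb := sub_ne_zero.2 h.hab
  have hode : ∀ t ∈ C, t * deriv (deriv f) t = (a' / a - 1) * deriv f t := by
    intro t ht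
    obtain ⟨x, hx, rfl⟩ := hC ht
    exact h.ode_of_four_lt hU hf hg hE hx
  have h0 : ∀ t ∈ C, t ≠ 0 := by
    intro t ht
    obtain ⟨x, hx, rfl⟩ := hC ht
    exact hU.subset hx
  have hn : ∀ t ∈ C, deriv f t ≠ 0 := by
    intro t ht hz
    have h1 := hode t ht
    obtain ⟨x, hx, rfl⟩ := hC ht
    refine h.coeff_ne_zero hU hf hg hx ?_
    rw [h1, hz]
    ring
  obtain ⟨A, hA, hAt⟩ := exists_const_mul_of_ode hpre h0 (w := deriv f) (w₀ := deriv f₀)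
    (fun t ht ↦ by
      obtain ⟨x, hx, rfl⟩ := hC ht
      exact (contDiffAt_deriv (hf x hx)).differentiableAt (by simp))
    (fun t ht ↦ (contDiffAt_deriv (hf₀.smooth t (h0 t ht))).differentiableAt (by simp))
    hode (fun t ht ↦ hf₀.ode t (h0 t ht)) hn (fun t ht ↦ hf₀.deriv_ne t (h0 t ht))
  refine ⟨A, hA, fun x hx hxC ↦ ?_⟩
  have h2 : deriv (deriv f) (potentialOf X g a b x) =
      A * deriv (deriv f₀) (potentialOf X g a b x) := by
    refine mul_left_cancel₀ (h0 _ hxC) ?_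
    linear_combination hode _ hxC - A * hf₀.ode _ (h0 _ hxC) + (a' / a - 1) * hAt _ hxC
  rw [h.eq_deformed hU hf hg hx, h.transformed_eq]
  ext u v
  simp only [deformed_apply, smul_apply, smul_eq_mul, coeffP, coeffR, hAt _ hxC, h2]
  ring

/-- In dimension four `g'` and `g_{f₀}` are multiples of `g`, and the factors solve the same
equation. -/
lemma homothetic_of_finrank_eq_four (hE : Module.finrank ℝ E = 4) (hk : a' / a ≠ b / a) :
    HomotheticOverIntervals g' (transformed g I J K (potentialOf X g a b) f₀)
      (potentialOf X g a b) U := by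
  intro C hC hpre
  have ha := h.ha
  have hb := sub_ne_zero.2 h.hab
  have h0 : ∀ t ∈ C, t ≠ 0 := by
    intro t ht
    obtain ⟨x, hx, rfl⟩ := hC ht
    exact hU.subset hx
  -- The factors by which the two metrics differ from `g`.
  set w : ℝ → ℝ := fun t ↦ deriv f t + a / (a - b) * (t * deriv (deriv f) t) with hw
  set w₀ : ℝ → ℝ := fun t ↦ (a' - b) / (a - b) * deriv f₀ t with hw₀
  have hab' : (a' - b) / (a - b) ≠ 0 := by
    refine div_ne_zero (sub_ne_zero.2 fun h1 ↦ hk ?_) hb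
    rw [h1]
  have hd₀ : ∀ t ∈ C, DifferentiableAt ℝ (deriv f₀) t := fun t ht ↦
    (contDiffAt_deriv (hf₀.smooth t (h0 t ht))).differentiableAt (by simp)
  obtain ⟨A, hA, hAt⟩ := exists_const_mul_of_ode hpre h0 (w := w) (w₀ := w₀) (k := a' / a)
    (fun t ht ↦ by
      obtain ⟨x, hx, rfl⟩ := hC ht
      have d1 := contDiffAt_deriv (hf x hx)
      have d2 := contDiffAt_deriv d1
      exact (d1.add (contDiffAt_const.mul (contDiffAt_id.mul d2))).differentiableAt (by simp))
    (fun t ht ↦ (hd₀ t ht).const_mul _)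
    (fun t ht ↦ by
      obtain ⟨x, hx, rfl⟩ := hC ht
      exact h.ode_on_span hU hf hg hx)
    (fun t ht ↦ by
      rw [((hd₀ t ht).hasDerivAt.const_mul _).deriv]
      linear_combination (a' - b) / (a - b) * hf₀.ode t (h0 t ht))
    (fun t ht ↦ by
      obtain ⟨x, hx, rfl⟩ := hC ht
      exact h.coeff_ne_zero hU hf hg hx)
    (fun t ht ↦ mul_ne_zero hab' (hf₀.deriv_ne t (h0 t ht)))
  refine ⟨A, hA, fun x hx hxC ↦ ?_⟩
  have : FiniteDimensional ℝ (TangentSpace 𝓘(ℝ, E) x) := inferInstanceAs (FiniteDimensional ℝ E)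
  have hS := (h.hyperHermitian x).quatSquare_eq (h.gXX_ne_zero (hU.subset hx)) hE
  have hdef : ∀ (F : ℝ → ℝ) u v, deformed g I J K X (coeffP X g a b F) (coeffR X g a b F) x u v =
      (deriv F (potentialOf X g a b x) + a / (a - b) * (potentialOf X g a b x *
        deriv (deriv F) (potentialOf X g a b x))) * g x u v := by
    intro F u v
    rw [deformed, add_apply, add_apply, smul_apply, smul_apply, smul_apply, smul_apply, hS,
      smul_eq_mul, smul_eq_mul, ← h.coeffR_mul_gXX, coeffP]
    ring
  have h1 : deriv f₀ (potentialOf X g a b x) + a / (a - b) * (potentialOf X g a b x *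
      deriv (deriv f₀) (potentialOf X g a b x)) = w₀ (potentialOf X g a b x) := by
    rw [hf₀.ode _ (h0 _ hxC)]
    simp only [hw₀]
    field_simp
    ring
  have h2 : deriv f (potentialOf X g a b x) + a / (a - b) * (potentialOf X g a b x *
      deriv (deriv f) (potentialOf X g a b x)) = A * w₀ (potentialOf X g a b x) := hAt _ hxC
  rw [h.eq_deformed hU hf hg hx, h.transformed_eq]
  ext u v
  rw [hdef, smul_apply, smul_apply, hdef, h1, h2, smul_eq_mul, mul_assoc]

end HomothetySetting

end

end HKTGeometry

end

theorem mainTheorem4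
    {E : Type*} [NormedAddCommGroup E] [NormedSpace ℝ E] [FiniteDimensional ℝ E]
    {M : Type*} [TopologicalSpace M] [T2Space M] [SecondCountableTopology M]
    [ChartedSpace E M] [IsManifold 𝓘(ℝ, E) ∞ M] [Nonempty M]
    (m : ℕ) (hm : 1 ≤ m) (hdim : Module.finrank ℝ E = 4 * m)
    (g : BilinField E M) (I J K : EndField E M) (X : VField E M) (a b : ℝ)
    (hHKT : IsHKTOn g I J K Set.univ)
    (hX : IsSpecialHomothetyOn X g I J K a b Set.univ)
    (ha : a ≠ 0) (hab : a ≠ b)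
    (μ : M → ℝ) (hμ : μ = potentialOf X g a b)
    (U : Set M) (hU : U = {x | μ x ≠ 0}) :
    (∀ k : ℝ, k ≠ 0 → k ≠ b / a →
      HasPotentialAndHomothetyOn (transformed g I J K μ (fun t ↦ |t| ^ k)) I J K X
        (fun x ↦ |μ x| ^ k) (k * a) b U) ∧
    (b ≠ 0 →
      HasPotentialAndHomothetyOn (transformed g I J K μ (fun t ↦ Real.log |t|)) I J K X
        (fun x ↦ Real.log |μ x|) 0 b U) ∧
    (∀ (f : ℝ → ℝ) (h : BilinField E M) (a' b' : ℝ),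
      (∀ x ∈ U, ContDiffAt ℝ ∞ f (μ x)) →
      HasPotentialAndHomothetyOn h I J K X (fun x ↦ f (μ x)) a' b' U →
      2 ≤ m ∨ a' ≠ b' →
      (∃ k : ℝ, k ≠ 0 ∧ k ≠ b / a ∧ a' = k * a ∧ b' = b ∧
        HomotheticOverIntervals h (transformed g I J K μ (fun t ↦ |t| ^ k)) μ U) ∨
      (b ≠ 0 ∧ a' = 0 ∧ b' = b ∧
        HomotheticOverIntervals h (transformed g I J K μ (fun t ↦ Real.log |t|)) μ U)) := by
  have := FiniteDimensional.complete ℝ E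
  have hE : 0 < Module.finrank ℝ E := by omega
  have : Nontrivial E := Module.finrank_pos_iff.1 hE
  obtain ⟨nabla, hnabla⟩ := hHKT.exists_connection
  have hs : HomothetySetting nabla g I J K X a b := ⟨hHKT, hnabla, hX, ha, hab⟩
  subst hμ
  refine ⟨fun k hk hkb ↦ ?_, fun hb ↦ ?_, fun f h a' b' hf hh hmab ↦ ?_⟩
  · rw [hU]
    exact hs.hasPotentialAndHomothetyOn_transformed (isPowerLike_rpow hk) hkb
  · rw [hU]
    have := hs.hasPotentialAndHomothetyOn_transformed isPowerLike_log (div_ne_zero hb ha).symm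
    rwa [zero_mul] at this
  · obtain ⟨x, hx⟩ := hs.exists_potentialOf_ne_zero
    have hxU : x ∈ U := hU ▸ hx
    have hbb : b' = b := hs.type_snd_eq hU hf hh hxU
    -- In dimension at least eight `a' = b` would make `h` degenerate on the span of `X`.
    have hk : a' / a ≠ b / a := by
      rcases hmab with hm2 | hne
      · intro hk
        refine hs.coeff_ne_zero hU hf hh hxU ?_
        rw [hs.ode_of_four_lt hU hf hh (by omega) hxU, hk]
        have := sub_ne_zero.2 hab
        field_simp
        ring
      · rw [hbb] at hne
        exact fun hk ↦ hne ((div_left_inj' ha).1 hk)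
    have key : ∀ f₀ : ℝ → ℝ, IsPowerLike f₀ (a' / a) →
        HomotheticOverIntervals h (transformed g I J K (potentialOf X g a b) f₀)
          (potentialOf X g a b) U := by
      intro f₀ hf₀
      rcases Nat.lt_or_ge 1 m with hm2 | hm1
      · exact hs.homothetic_of_four_lt hU hf hh hf₀ (by omega)
      · exact hs.homothetic_of_finrank_eq_four hU hf hh hf₀ (by omega) hk
    by_cases ha' : a' = 0
    · refine Or.inr ⟨fun hb ↦ hk ?_, ha', hbb, key _ ?_⟩
      · rw [ha', hb]
      · rw [ha', zero_div]
        exact isPowerLike_log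
    · exact Or.inl ⟨a' / a, div_ne_zero ha' ha, hk, (div_mul_cancel₀ a' ha).symm, hbb,
        key _ (isPowerLike_rpow (div_ne_zero ha' ha))⟩
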